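/- Let $\mathbb K$ be an algebraically closed field of characteristic zero. A locally nilpotent derivation (LND) of a $\mathbb K$-algebra $C$ is a $\mathbb K$-derivation $\partial$ of $C$ such that every element is killed by some power of $\partial$; it has a slice if $\partial(s)=1$ for some $s\in C$. For an affine variety $X$, let $\mathrm{HD}^*(X)\subseteq\mathbb K[X]$ be the subalgebra generated by the kernels of all LNDs of $\mathbb K[X]$ that have a slice. An affine variety $Y$ is rigid if $0$ is the only LND of $\mathbb K[Y]$; it is of type A if $\mathrm{HD}^*(Y\times\mathbb A^1)=\mathbb K[Y\times\mathbb A^1]$, and of type B if $\mathrm{HD}^*(Y\times\mathbb A^1)$ is not finitely generated. Fix integers $r>0$, $m\ge 0$ and $q\in\{0,1\}$, integers $n_i>0$ and $l_{ij}>0$ for $q\le i\le r$, $1\le j\le n_i$, and put $T_i^{l_i}=\prod_{j=1}^{n_i}T_{ij}^{l_{ij}}$ in $\mathbb K[T_{ij},S_k\mid q\le i\le r,\ 1\le j\le n_i,\ 1\le k\le m]$. Type 1: $q=1$, $a_1,\dots,a_r\in\mathbb K$ are pairwise distinct, and $g_i=T_i^{l_i}-T_{i+1}^{l_{i+1}}-(a_{i+1}-a_i)$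 for $i\in I=\{1,\dots,r-1\}$. Type 2: $q=0$, $(a_{st})$ is a $2\times(r+1)$ matrix over $\mathbb K$ with pairwise linearly independent columns (indexed by $0,\dots,r$), and $$g_i=\det\begin{pmatrix}T_i^{l_i}&T_{i+1}^{l_{i+1}}&T_{i+2}^{l_{i+2}}\\ a_{0,i}&a_{0,i+1}&a_{0,i+2}\\ a_{1,i}&a_{1,i+1}&a_{1,i+2}\end{pmatrix}\quad\text{for } i\in I=\{0,\dots,r-2\}.$$ A trinomial variety (of Type 1 or 2, with these data) is a variety $Y$ isomorphic to $\mathrm{Spec}\,\mathbb K[T_{ij},S_k]/(g_i\mid i\in I)$. Let $Y$ be a nonrigid trinomial variety. Then: 1. if $m>0$, then $Y$ is of type A; 2. if $Y$ is of Type 1, then $Y$ is of type A; 3. if $Y$ is of Type 2, $m=0$, and at least three of the monomials $T_0^{l_0},\dots,T_r^{l_r}$ do not consist of a single variable to the first power (for Type 2 with $m=0$ this says exactly that $Y$ is not isomorphic to an affine space), then $Y$ is of type B. -/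

import Mathlib

open scoped Polynomial

/-- A `K`-derivation `D` of `C` is locally nilpotent (an LND) if every element is killed by some
iterate of `D`. -/
def IsLND {K C : Type*} [CommRing K] [CommRing C] [Algebra K C] (D : Derivation K C C) : Prop :=
  ∀ f : C, ∃ k : ℕ, (⇑D)^[k] f = 0

/-- `D` has a slice: an element `s` with `D s = 1`. -/
def HasSlice {K C : Type*} [CommRing K] [CommRing C] [Algebra K C] (D : Derivation K C C) : Prop :=
  ∃ s : C, D s = 1

/-- The affine variety with coordinate algebra `C` is rigid: its only LND is zero. -/
def IsRigid (K C : Type*) [CommRing K] [CommRing C] [Algebra K C] : Prop :=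
  ∀ D : Derivation K C C, IsLND D → D = 0

/-- The modified Derksen invariant `HD*`: the subalgebra generated by the kernels of all LNDs that
have a slice. -/
def HDStar (K C : Type*) [CommRing K] [CommRing C] [Algebra K C] : Subalgebra K C :=
  Algebra.adjoin K {f | ∃ D : Derivation K C C, IsLND D ∧ HasSlice D ∧ D f = 0}

/-- The affine variety `Y` with `K[Y] = B` is of type A: `HD*(Y × 𝔸¹) = K[Y × 𝔸¹]`, where
`K[Y × 𝔸¹] = B[u]`. -/
def IsOfTypeA (K B : Type*) [CommRing K] [CommRing B] [Algebra K B] : Prop :=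
  HDStar K B[X] = ⊤

/-- The affine variety `Y` with `K[Y] = B` is of type B: `HD*(Y × 𝔸¹)` is not a finitely generated
`K`-algebra. -/
def IsOfTypeB (K B : Type*) [CommRing K] [CommRing B] [Algebra K B] : Prop :=
  ¬ (HDStar K B[X]).FG

/-- The combinatorial part of the data of a trinomial variety with `N` monomials: the block sizes
`nᵢ > 0`, the exponents `lᵢⱼ > 0` and the number `m` of free variables `Sₖ`. -/
structure TrinomialExponents (N : ℕ) where
  n : Fin N → ℕ
  n_pos : ∀ i, 0 < n i
  l : ∀ i, Fin (n i) → ℕ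
  l_pos : ∀ i j, 0 < l i j
  m : ℕ

namespace TrinomialExponents

variable {N : ℕ} (E : TrinomialExponents N)

/-- The variables: `Tᵢⱼ` is `Sum.inl ⟨i, j⟩` and `Sₖ` is `Sum.inr k`. -/
abbrev Var : Type := (Σ i : Fin N, Fin (E.n i)) ⊕ Fin E.m

/-- The monomial `Tᵢ^{lᵢ} = ∏ⱼ Tᵢⱼ ^ lᵢⱼ`. -/
noncomputable def monomial (K : Type*) [Field K] (i : Fin N) : MvPolynomial E.Var K :=
  ∏ j : Fin (E.n i), MvPolynomial.X (Sum.inl ⟨i, j⟩) ^ E.l i j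

/-- The monomial `Tᵢ^{lᵢ}` is a single variable `Tᵢ₁`. -/
def IsSingleVariable (i : Fin N) : Prop := E.n i = 1 ∧ ∀ j, E.l i j = 1

end TrinomialExponents

/-- Data of Type 1. The indices `1, …, r` of the monomials are shifted to `0, …, r - 1`. -/
structure TrinomialDataOne (K : Type*) [Field K] where
  r : ℕ
  r_pos : 0 < r
  E : TrinomialExponents r
  a : Fin r → K
  a_injective : Function.Injective a

namespace TrinomialDataOne

variable {K : Type*} [Field K] (D : TrinomialDataOne K)

/-- `gᵢ = Tᵢ^{lᵢ} - Tᵢ₊₁^{lᵢ₊₁} - (aᵢ₊₁ - aᵢ)`. -/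
noncomputable def g (i : ℕ) (hi : i + 1 < D.r) : MvPolynomial D.E.Var K :=
  D.E.monomial K ⟨i, by omega⟩ - D.E.monomial K ⟨i + 1, hi⟩
    - MvPolynomial.C (D.a ⟨i + 1, hi⟩ - D.a ⟨i, by omega⟩)

noncomputable def ideal : Ideal (MvPolynomial D.E.Var K) :=
  Ideal.span {f | ∃ (i : ℕ) (hi : i + 1 < D.r), f = D.g i hi}

/-- The algebra `R(A)`. -/
abbrev R : Type _ := MvPolynomial D.E.Var K ⧸ D.ideal

end TrinomialDataOne

/-- Data of Type 2. The monomials are indexed by `0, …, r`. -/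
structure TrinomialDataTwo (K : Type*) [Field K] where
  r : ℕ
  r_pos : 0 < r
  E : TrinomialExponents (r + 1)
  A : Matrix (Fin 2) (Fin (r + 1)) K
  A_pairwise : ∀ i j, i ≠ j → LinearIndependent K ![A.col i, A.col j]

namespace TrinomialDataTwo

variable {K : Type*} [Field K] (D : TrinomialDataTwo K)

/-- The `3 × 3` determinant with rows `(Tᵢ^{lᵢ}, Tᵢ₊₁^{lᵢ₊₁}, Tᵢ₊₂^{lᵢ₊₂})`, `(a₀ᵢ, a₀ᵢ₊₁, a₀ᵢ₊₂)`
and `(a₁ᵢ, a₁ᵢ₊₁, a₁ᵢ₊₂)`. -/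
noncomputable def g (i : ℕ) (hi : i + 2 < D.r + 1) : MvPolynomial D.E.Var K :=
  let c : Fin 3 → Fin (D.r + 1) := ![⟨i, by omega⟩, ⟨i + 1, by omega⟩, ⟨i + 2, hi⟩]
  Matrix.det (Matrix.of ![fun k => D.E.monomial K (c k),
    fun k => MvPolynomial.C (D.A 0 (c k)),
    fun k => MvPolynomial.C (D.A 1 (c k))])

noncomputable def ideal : Ideal (MvPolynomial D.E.Var K) :=
  Ideal.span {f | ∃ (i : ℕ) (hi : i + 2 < D.r + 1), f = D.g i hi}

/-- The algebra `R(A)`. -/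
abbrev R : Type _ := MvPolynomial D.E.Var K ⧸ D.ideal

end TrinomialDataTwo

/-! Type A comes from exponentials. If `d` is an LND of `B` and k ≥ 1, then ∂/∂u + k u^(k-1) d is an
LND of `B[u]` with slice u, and its kernel contains exp(-u^k d) b. Since also B ⊆ ker ∂/∂u,
induction on the nilpotency order of b puts every u^k d(b) into HD* (`X_pow_mul_C_mem_HDStar`).
Hence Y is of type A as soon as the images of the LNDs of `B` generate the unit ideal; a free
variable S_k even gives an LND with a slice.

In Type 1 all the functions T_i^{l_i} + a_i coincide; call their common value t. If all monomials
but at most one contain a variable to the first power, a Jacobian-type LND sends a chosen variable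
of block i to a divisor of ∏_{k≠i} (t - a_k), and Lagrange interpolation combines these products to
1. Otherwise two monomials have all exponents at least 2, and for m = 0 the variety is rigid: along
an orbit of an LND they become polynomials whose difference is a nonzero constant, and a degree
count in the style of Mason–Stothers makes them constant (`derivative_eq_zero_of_sub_eq_C`). So an
LND kills every coordinate at every point with nonzero coordinates, and such points detect zero in
R(A) (`eq_zero_of_evalAt_eq_zero`).

For type B, every derivation of `R[u]` preserves the ideal of the line over the origin
(`map_origin_derivation_coord`): the relations among the monomials express T_i^{l_i} through two
monomials of degree at least 2, and testing on a jet of a curve in the variables of block i shows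
that the image of T_ij vanishes on the line. A derivation with a slice therefore restricts to a
nonzero derivation of K[u], so HD* restricts to constants there. For a positive grading with B₀ = K,
finite generation would bound the u-degree of the component of weight n by nM; but u^k d(b) lies in
HD* for all k ≥ 1 and some nonzero d(b). -/

/-! ### Locally nilpotent elements of a derivation -/

section LocallyNilpotent

variable {K C : Type*} [CommRing K] [CommRing C] [Algebra K C]

/-- The elements killed by some iterate of `D`. -/
def Derivation.IsNilAt (D : Derivation K C C) (f : C) : Prop := ∃ k : ℕ, (⇑D)^[k] f = 0

namespace Derivation

variable (D : Derivation K C C)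

theorem iterate_zero (k : ℕ) : (⇑D)^[k] 0 = 0 := Function.iterate_fixed (map_zero D) k

theorem iterate_add_apply (k : ℕ) (f g : C) : (⇑D)^[k] (f + g) = (⇑D)^[k] f + (⇑D)^[k] g := by
  induction k generalizing f g with
  | zero => rfl
  | succ k ih => rw [Function.iterate_succ_apply, map_add, ih]; rfl

theorem iterate_eq_zero_of_le {f : C} {k n : ℕ} (h : (⇑D)^[k] f = 0) (hkn : k ≤ n) :
    (⇑D)^[n] f = 0 := by
  obtain ⟨m, rfl⟩ := Nat.exists_eq_add_of_le' hkn
  rw [Function.iterate_add_apply, h, D.iterate_zero]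

variable {D}

theorem IsNilAt.add {f g : C} (hf : D.IsNilAt f) (hg : D.IsNilAt g) : D.IsNilAt (f + g) := by
  obtain ⟨m, hm⟩ := hf
  obtain ⟨n, hn⟩ := hg
  refine ⟨max m n, ?_⟩
  rw [iterate_add_apply, D.iterate_eq_zero_of_le hm (le_max_left _ _),
    D.iterate_eq_zero_of_le hn (le_max_right _ _), add_zero]

theorem isNilAt_of_apply {f : C} (h : D.IsNilAt (D f)) : D.IsNilAt f := by
  obtain ⟨k, hk⟩ := h
  exact ⟨k + 1, hk⟩

theorem isNilAt_zero : D.IsNilAt 0 := ⟨0, rfl⟩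

theorem isNilAt_of_apply_eq_zero {f : C} (h : D f = 0) : D.IsNilAt f := ⟨1, h⟩

/-- Each summand of the Leibniz rule for `f * g` lowers the nilpotency order of one factor, whence
the double induction. -/
theorem IsNilAt.mul {f g : C} (hf : D.IsNilAt f) (hg : D.IsNilAt g) : D.IsNilAt (f * g) := by
  obtain ⟨m, hm⟩ := hf
  obtain ⟨n, hn⟩ := hg
  induction m generalizing f g n with
  | zero =>
    simp only [Function.iterate_zero, id] at hm
    simpa [hm] using isNilAt_zero
  | succ m ihm =>
    induction n generalizing g with
    | zero =>
      simp only [Function.iterate_zero, id] at hn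
      simpa [hn] using isNilAt_zero
    | succ n ihn =>
      apply isNilAt_of_apply
      rw [leibniz, smul_eq_mul, smul_eq_mul, mul_comm g]
      exact (ihn hn).add (ihm hm (n + 1) hn)

variable (D) in
/-- The locally nilpotent elements form a subalgebra. -/
def nilSubalgebra : Subalgebra K C where
  carrier := {f | D.IsNilAt f}
  mul_mem' := IsNilAt.mul
  add_mem' := IsNilAt.add
  algebraMap_mem' r := isNilAt_of_apply_eq_zero (D.map_algebraMap r)

theorem isLND_iff : IsLND D ↔ D.nilSubalgebra = ⊤ := by
  rw [Algebra.eq_top_iff]; rfl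

end Derivation

end LocallyNilpotent

/-! ### Invariance under isomorphism -/

section Transfer

variable {K : Type*} [CommRing K] {C C' : Type*} [CommRing C] [CommRing C'] [Algebra K C]
  [Algebra K C']

theorem IsLND.liftOfSurjective {f : C →ₐ[K] C'} (hf : Function.Surjective f)
    {D : Derivation K C C} (hD : ∀ x, f x = 0 → f (D x) = 0) (h : IsLND D) :
    IsLND (Derivation.liftOfSurjective hf hD) := by
  intro y
  obtain ⟨x, rfl⟩ := hf y
  obtain ⟨k, hk⟩ := h x
  refine ⟨k, ?_⟩
  have : Function.Semiconj f D (Derivation.liftOfSurjective hf hD) := fun x =>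
    (Derivation.liftOfSurjective_apply hf hD x).symm
  rw [← (this.iterate_right k).eq, hk, map_zero]

theorem exists_isLND_conj (e : C ≃ₐ[K] C') {D : Derivation K C C} (h : IsLND D) :
    ∃ D' : Derivation K C' C', IsLND D' ∧ ∀ x, D' (e x) = e (D x) := by
  have hD : ∀ x, (e : C →ₐ[K] C') x = 0 → (e : C →ₐ[K] C') (D x) = 0 := by
    intro x hx
    obtain rfl : x = 0 := by simpa using hx
    simp
  exact ⟨_, h.liftOfSurjective e.surjective hD, fun x =>
    Derivation.liftOfSurjective_apply (f := (e : C →ₐ[K] C')) e.surjective hD x⟩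

theorem IsRigid.of_equiv (e : C ≃ₐ[K] C') (h : IsRigid K C') : IsRigid K C := by
  intro D hD
  obtain ⟨D', hD', hx⟩ := exists_isLND_conj e hD
  ext x
  apply e.injective
  rw [← hx, h D' hD']
  simp

theorem HDStar_map_le (e : C ≃ₐ[K] C') :
    (HDStar K C).map (e : C →ₐ[K] C') ≤ HDStar K C' := by
  rw [HDStar, AlgHom.map_adjoin, Algebra.adjoin_le_iff]
  rintro _ ⟨f, ⟨D, hD, ⟨s, hs⟩, hf⟩, rfl⟩
  obtain ⟨D', hD', hx⟩ := exists_isLND_conj e hD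
  refine Algebra.subset_adjoin ⟨D', hD', ⟨e s, by rw [hx, hs, map_one]⟩, ?_⟩
  simpa [hf] using hx f

theorem HDStar_map (e : C ≃ₐ[K] C') :
    (HDStar K C).map (e : C →ₐ[K] C') = HDStar K C' := by
  refine le_antisymm (HDStar_map_le e) fun x hx => ?_
  refine ⟨e.symm x, HDStar_map_le e.symm ⟨x, hx, rfl⟩, e.apply_symm_apply x⟩

theorem IsOfTypeA.of_equiv (e : C ≃ₐ[K] C') (h : IsOfTypeA K C) : IsOfTypeA K C' := by
  unfold IsOfTypeA at *
  rw [← HDStar_map (Polynomial.mapAlgEquiv e), h, Algebra.map_top, AlgHom.range_eq_top]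
  exact (Polynomial.mapAlgEquiv e).surjective

theorem IsOfTypeB.of_equiv (e : C ≃ₐ[K] C') (h : IsOfTypeB K C) : IsOfTypeB K C' := by
  refine fun h' => h ?_
  rw [← HDStar_map (Polynomial.mapAlgEquiv e.symm)]
  exact h'.map _

end Transfer

/-! ### Exponentials on the cylinder and a criterion for type A -/

section Cylinder

open Polynomial

variable {K B : Type*} [Field K] [CommRing B] [Algebra K B]

theorem C_mem_HDStar (b : B) : C b ∈ HDStar K B[X] := by
  refine Algebra.subset_adjoin ⟨(derivative' (R := B)).restrictScalars K, fun f => ?_,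
    ⟨X, by simp⟩, by simp⟩
  exact ⟨f.natDegree + 1, iterate_derivative_eq_zero (Nat.lt_succ_self _)⟩

/-- The derivation of `B[X]` that applies `d` to the coefficients. -/
noncomputable def Derivation.coeffwise (d : Derivation K B B) : Derivation K B[X] B[X] :=
  (PolynomialModule.equivPolynomialSelf (R := B)).toLinearMap.compDer d.mapCoeffs

theorem Derivation.coeffwise_C (d : Derivation K B B) (b : B) :
    d.coeffwise (C b) = C (d b) := by
  ext n
  simp [Derivation.coeffwise]

theorem Derivation.coeffwise_X (d : Derivation K B B) : d.coeffwise X = 0 := by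
  simp [Derivation.coeffwise]

/-- The derivation `∂/∂X + k X^(k-1) d`. -/
noncomputable def Derivation.shear (d : Derivation K B B) (k : ℕ) : Derivation K B[X] B[X] :=
  (derivative' (R := B)).restrictScalars K + ((k : B[X]) * X ^ (k - 1)) • d.coeffwise

namespace Derivation

variable (d : Derivation K B B) (k : ℕ)

theorem shear_X : d.shear k X = 1 := by simp [shear, coeffwise_X]

theorem shear_C (b : B) : d.shear k (C b) = (k : B[X]) * X ^ (k - 1) * C (d b) := by
  simp [shear, coeffwise_C]

variable {d}

/-- The shear sends `C b` to a multiple of `C (d b)` by a nilpotent element, so induction on the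
order of `b` under `d` applies. -/
theorem isLND_shear (hd : IsLND d) : IsLND (d.shear k) := by
  have hX : (d.shear k).IsNilAt X := ⟨2, by simp [shear_X]⟩
  have hC (b : B) : (d.shear k).IsNilAt (C b) := by
    obtain ⟨n, hn⟩ := hd b
    induction n generalizing b with
    | zero =>
      simp only [Function.iterate_zero, id] at hn
      simpa [hn] using isNilAt_zero
    | succ n ih =>
      apply isNilAt_of_apply
      rw [shear_C]
      refine IsNilAt.mul (IsNilAt.mul (isNilAt_of_apply_eq_zero (by simp)) ?_) (ih _ hn)
      exact pow_mem (S := (d.shear k).nilSubalgebra) hX _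
  intro f
  induction f using Polynomial.induction_on' with
  | add p q hp hq => exact IsNilAt.add hp hq
  | monomial n a =>
    rw [← C_mul_X_pow_eq_monomial]
    exact (hC a).mul (pow_mem (S := (d.shear k).nilSubalgebra) hX _)

variable (d) in
/-- Truncations of `exp(-X^k d) b`. -/
noncomputable def expTrunc (b : B) (N : ℕ) : B[X] :=
  ∑ j ∈ Finset.range N, ((-1) ^ j / (j.factorial : K)) • (X ^ (j * k) * C ((⇑d)^[j] b))

variable [CharZero K]

/-- The series exp(-X^k d) b is formally killed by the shear; in a truncation the terms telescope
and only the last one survives. -/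
theorem shear_expTrunc (hk : 1 ≤ k) (b : B) (N : ℕ) :
    d.shear k (d.expTrunc k b (N + 1)) =
      ((-1) ^ N / (N.factorial : K)) • ((k : B[X]) * X ^ (N * k + k - 1) * C ((⇑d)^[N + 1] b)) := by
  obtain ⟨k, rfl⟩ : ∃ l, k = l + 1 := ⟨k - 1, by omega⟩
  induction N with
  | zero => simp [expTrunc, shear_C]
  | succ N ih =>
    rw [expTrunc, Finset.sum_range_succ, map_add, ← expTrunc, ih, Derivation.map_smul,
      Derivation.leibniz, Derivation.leibniz_pow, shear_C, shear_X,
      ← Function.iterate_succ_apply' (⇑d)]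
    have e1 : ((-1) ^ N / (N.factorial : K)) = -(N + 1) * ((-1) ^ (N + 1) / ((N + 1).factorial : K)) := by
      have : (N.factorial : K) ≠ 0 := by exact_mod_cast N.factorial_ne_zero
      have : (N + 1 : K) ≠ 0 := by exact_mod_cast N.succ_ne_zero
      rw [Nat.factorial_succ]
      push_cast
      field_simp
      ring
    rw [e1, mul_smul, smul_comm, ← smul_add]
    congr 1
    have e2 (p : B[X]) : (-((N : K) + 1)) • p = -((N : B[X]) + 1) * p := by
      rw [Algebra.smul_def]; simp
    rw [e2]
    have h1 : N * (k + 1) + (k + 1) - 1 = N * (k + 1) + k := by omega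
    have h2 : (N + 1) * (k + 1) - 1 = N * (k + 1) + k := by rw [Nat.succ_mul]; omega
    have h3 : (N + 1) * (k + 1) + (k + 1) - 1 = N * (k + 1) + k + 1 + k := by
      rw [Nat.succ_mul]; omega
    rw [h1, h2, h3]
    simp only [Nat.add_sub_cancel, smul_eq_mul, nsmul_eq_mul]
    push_cast
    ring

/-- The full exponential of `b` lies in a kernel. Its constant term is a coefficient, its terms of
index j ≥ 2 have the form X^(jk) d(d^(j-1) b) with d^(j-1) b of smaller order, and what is left is
-X^k d(b). The induction must cover all exponents `k`, since it is used at jk. -/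
theorem X_pow_mul_C_mem_HDStar (hd : IsLND d) (hk : 1 ≤ k) (b : B) :
    X ^ k * C (d b) ∈ HDStar K B[X] := by
  obtain ⟨n, hn⟩ := hd b
  induction n using Nat.strong_induction_on generalizing k b with
  | _ n ih =>
    match n, hn with
    | 0, hn =>
      simp only [Function.iterate_zero, id] at hn
      simp [hn]
    | 1, hn =>
      simp only [Function.iterate_one] at hn
      simp [hn]
    | n + 2, hn =>
      have hker : d.expTrunc k b (n + 2) ∈ HDStar K B[X] := by
        refine Algebra.subset_adjoin ⟨d.shear k, isLND_shear k hd, ⟨X, d.shear_X k⟩, ?_⟩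
        rw [shear_expTrunc k hk, hn]
        simp
      rw [expTrunc, Finset.sum_range_succ', Finset.sum_range_succ'] at hker
      have h0 : ∑ j ∈ Finset.range n, ((-1) ^ (j + 1 + 1) / ((j + 1 + 1).factorial : K)) •
          (X ^ ((j + 1 + 1) * k) * C ((⇑d)^[j + 1 + 1] b)) ∈ HDStar K B[X] := by
        refine sum_mem fun j _ => Subalgebra.smul_mem _ ?_ _
        rw [Function.iterate_succ_apply']
        refine ih (n + 1 - j) (by omega) _ (Nat.mul_pos (by omega) hk) _ ?_
        rw [← Function.iterate_add_apply]
        exact d.iterate_eq_zero_of_le hn (by omega)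
      have h1 := sub_mem (sub_mem hker h0) (C_mem_HDStar (K := K) b)
      convert neg_mem h1 using 1
      simp only [zero_add, Function.iterate_one, Function.iterate_zero, id, pow_zero, pow_one,
        Nat.factorial_zero, Nat.factorial_one, Nat.cast_one, div_one, one_smul, one_mul, zero_mul,
        neg_smul]
      ring

end Derivation

variable [CharZero K]

/-- If the images of the LNDs generate the unit ideal, the variety is of type A. -/
theorem isOfTypeA_of_span_eq_top
    (h : Ideal.span {f : B | ∃ d : Derivation K B B, IsLND d ∧ ∃ b, d b = f} = ⊤) :
    IsOfTypeA K B := by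
  have hmul (f : B) : X * C f ∈ HDStar K B[X] := by
    have hf : f ∈ Ideal.span {f : B | ∃ d : Derivation K B B, IsLND d ∧ ∃ b, d b = f} := by
      rw [h]; trivial
    induction hf using Submodule.span_induction with
    | mem f hf =>
      obtain ⟨d, hd, b, rfl⟩ := hf
      simpa using Derivation.X_pow_mul_C_mem_HDStar 1 hd le_rfl b
    | zero => simp
    | add f g _ _ hf hg => simpa [mul_add] using add_mem hf hg
    | smul a f _ hf =>
      have := mul_mem (C_mem_HDStar (K := K) a) hf
      rw [smul_eq_mul, C_mul]
      convert this using 1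
      ring
  have hX : X ∈ HDStar K B[X] := by simpa using hmul 1
  rw [IsOfTypeA, Algebra.eq_top_iff]
  intro f
  induction f using Polynomial.induction_on' with
  | add p q hp hq => exact add_mem hp hq
  | monomial n a =>
    rw [← C_mul_X_pow_eq_monomial]
    exact mul_mem (C_mem_HDStar a) (pow_mem hX n)

theorem isOfTypeA_of_hasSlice {d : Derivation K B B} (hd : IsLND d) (hs : HasSlice d) :
    IsOfTypeA K B := by
  obtain ⟨s, hs⟩ := hs
  refine isOfTypeA_of_span_eq_top ((Ideal.eq_top_iff_one _).2 (Ideal.subset_span ⟨d, hd, s, hs⟩))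

end Cylinder

/-! ### Derivations of quotients of polynomial rings -/

section Descent

variable {K : Type*} [CommRing K]

/-- The kernel of a derivation. -/
def Derivation.constants {C : Type*} [CommRing C] [Algebra K C] (D : Derivation K C C) :
    Subalgebra K C where
  carrier := {f | D f = 0}
  mul_mem' {f g} hf hg := by
    rw [Set.mem_ofPred_eq] at *
    simp [hf, hg]
  add_mem' {f g} hf hg := by
    rw [Set.mem_ofPred_eq] at *
    simp [hf, hg]
  algebraMap_mem' := D.map_algebraMap

theorem Derivation.mem_constants {C : Type*} [CommRing C] [Algebra K C] {D : Derivation K C C}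
    {f : C} : f ∈ D.constants ↔ D f = 0 := Iff.rfl

theorem Derivation.constants_le_nilSubalgebra {C : Type*} [CommRing C] [Algebra K C]
    (D : Derivation K C C) : D.constants ≤ D.nilSubalgebra :=
  fun _ hf => isNilAt_of_apply_eq_zero hf

theorem exists_isLND_quotient {P : Type*} [CommRing P] [Algebra K P] {d : Derivation K P P}
    (hd : IsLND d) {S : Set P} (hS : ∀ s ∈ S, d s = 0) :
    ∃ d' : Derivation K (P ⧸ Ideal.span S) (P ⧸ Ideal.span S), IsLND d' ∧
      ∀ x, d' (Ideal.Quotient.mk _ x) = Ideal.Quotient.mk _ (d x) := by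
  have h (x : P) (hx : Ideal.Quotient.mkₐ K (Ideal.span S) x = 0) :
      Ideal.Quotient.mkₐ K (Ideal.span S) (d x) = 0 := by
    rw [Ideal.Quotient.mkₐ_eq_mk, Ideal.Quotient.eq_zero_iff_mem] at *
    induction hx using Submodule.span_induction with
    | mem s hs => simp [hS s hs]
    | zero => simp
    | add x y _ _ hx hy => simpa using add_mem hx hy
    | smul a x hx' hx =>
      rw [smul_eq_mul, Derivation.leibniz]
      exact add_mem (Ideal.mul_mem_left _ _ hx) (Ideal.mul_mem_right _ _ hx')
  exact ⟨_, hd.liftOfSurjective (Ideal.Quotient.mkₐ_surjective K _) h, fun x =>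
    Derivation.liftOfSurjective_apply (f := Ideal.Quotient.mkₐ K (Ideal.span S)) _ h x⟩

theorem isLND_of_isNilAt_X {σ : Type*} {d : Derivation K (MvPolynomial σ K) (MvPolynomial σ K)}
    (h : ∀ v, d.IsNilAt (MvPolynomial.X v)) : IsLND d := by
  rw [Derivation.isLND_iff, eq_top_iff, ← MvPolynomial.adjoin_range_X, Algebra.adjoin_le_iff]
  rintro _ ⟨v, rfl⟩
  exact h v

theorem isLND_pderiv {σ : Type*} (v : σ) : IsLND (MvPolynomial.pderiv (R := K) v) := by
  classical
  refine isLND_of_isNilAt_X fun w => Derivation.isNilAt_of_apply ?_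
  rw [MvPolynomial.pderiv_X, Pi.single_apply]
  split_ifs
  · exact Derivation.isNilAt_of_apply_eq_zero (Derivation.map_one_eq_zero _)
  · exact Derivation.isNilAt_zero

theorem isOfTypeA_of_pderiv_eq_zero {K : Type*} [Field K] [CharZero K] {σ : Type*} (v : σ)
    {S : Set (MvPolynomial σ K)} (hS : ∀ s ∈ S, MvPolynomial.pderiv v s = 0) :
    IsOfTypeA K (MvPolynomial σ K ⧸ Ideal.span S) := by
  obtain ⟨d, hd, h⟩ := exists_isLND_quotient (isLND_pderiv v) hS
  exact isOfTypeA_of_hasSlice hd ⟨Ideal.Quotient.mk _ (MvPolynomial.X v), by simp [h]⟩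

theorem MvPolynomial.subalgebra_quotient_eq_top {σ : Type*} {I : Ideal (MvPolynomial σ K)}
    {S : Subalgebra K (MvPolynomial σ K ⧸ I)} (h : ∀ v, Ideal.Quotient.mk I (X v) ∈ S) :
    S = ⊤ := by
  rw [eq_top_iff, ← (AlgHom.range_eq_top _).2 (Ideal.Quotient.mkₐ_surjective K I),
    ← Algebra.map_top, ← MvPolynomial.adjoin_range_X, AlgHom.map_adjoin, Algebra.adjoin_le_iff]
  rintro _ ⟨_, ⟨v, rfl⟩, rfl⟩
  exact h v

end Descent

/-! ### The Jacobian-type derivation of a system of monomials -/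

namespace TrinomialExponents

open MvPolynomial

variable {N : ℕ} (E : TrinomialExponents N) {K : Type*} [Field K]

variable (K) in
/-- The product of the powers of the variables of the `i`-th block other than `Tᵢⱼ`. -/
noncomputable def cofactor (i : Fin N) (j : Fin (E.n i)) : MvPolynomial E.Var K :=
  ∏ j' ∈ Finset.univ.erase j, X (Sum.inl ⟨i, j'⟩) ^ E.l i j'

theorem monomial_eq (i : Fin N) (j : Fin (E.n i)) :
    E.monomial K i = X (Sum.inl ⟨i, j⟩) ^ E.l i j * E.cofactor K i j :=
  (Finset.mul_prod_erase _ _ (Finset.mem_univ j)).symm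

theorem pderiv_cofactor (i : Fin N) (j : Fin (E.n i)) (v : E.Var)
    (hv : ∀ j', v = Sum.inl ⟨i, j'⟩ → j' = j) : pderiv v (E.cofactor K i j) = 0 := by
  refine Subalgebra.prod_mem (pderiv v).constants fun j' hj' => ?_
  refine pow_mem (S := (pderiv v).constants) ?_ _
  refine pderiv_X_of_ne fun h => ?_
  exact Finset.ne_of_mem_erase hj' (hv j' h.symm)

theorem pderiv_monomial_eq_zero (i : Fin N) (v : E.Var) (hv : ∀ j, v ≠ Sum.inl ⟨i, j⟩) :
    pderiv v (E.monomial K i) = 0 := by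
  refine Subalgebra.prod_mem (pderiv v).constants fun j _ => ?_
  exact pow_mem (S := (pderiv v).constants) (pderiv_X_of_ne (hv j).symm) _

theorem pderiv_monomial_self (i : Fin N) (j : Fin (E.n i)) :
    pderiv (Sum.inl ⟨i, j⟩) (E.monomial K i) =
      (E.l i j : MvPolynomial E.Var K) * X (Sum.inl ⟨i, j⟩) ^ (E.l i j - 1) * E.cofactor K i j := by
  rw [E.monomial_eq i j, Derivation.leibniz, E.pderiv_cofactor i j, Derivation.leibniz_pow,
    pderiv_X_self]
  · simp only [smul_eq_mul, nsmul_eq_mul, mul_zero, mul_one, zero_add]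
    ring
  · rintro j' h
    simpa using h.symm

variable (K) in
/-- The derivation `∑ᵢ (∏_{k ≠ i} ∂Tₖ^{lₖ}/∂T_{k j(k)}) ∂/∂T_{i j(i)}`. -/
noncomputable def primitiveDerivation (j : ∀ i, Fin (E.n i)) :
    Derivation K (MvPolynomial E.Var K) (MvPolynomial E.Var K) :=
  ∑ i, (∏ k ∈ Finset.univ.erase i, pderiv (Sum.inl ⟨k, j k⟩) (E.monomial K k)) •
    pderiv (Sum.inl ⟨i, j i⟩)

variable (j : ∀ i, Fin (E.n i))

theorem primitiveDerivation_apply (f : MvPolynomial E.Var K) :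
    E.primitiveDerivation K j f =
      ∑ i, (∏ k ∈ Finset.univ.erase i, pderiv (Sum.inl ⟨k, j k⟩) (E.monomial K k)) *
        pderiv (Sum.inl ⟨i, j i⟩) f := by
  rw [primitiveDerivation, ← Derivation.coeFnAddMonoidHom_apply, map_sum, Finset.sum_apply]
  rfl

theorem primitiveDerivation_monomial (i : Fin N) :
    E.primitiveDerivation K j (E.monomial K i) =
      ∏ k, pderiv (Sum.inl ⟨k, j k⟩) (E.monomial K k) := by
  rw [primitiveDerivation_apply, Finset.sum_eq_single i, Finset.prod_erase_mul _ _ (Finset.mem_univ i)]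
  · intro k _ hk
    rw [E.pderiv_monomial_eq_zero i, mul_zero]
    rintro j' h
    simp only [Sum.inl.injEq, Sigma.mk.injEq] at h
    exact hk h.1
  · simp

theorem primitiveDerivation_X (i : Fin N) :
    E.primitiveDerivation K j (X (Sum.inl ⟨i, j i⟩)) =
      ∏ k ∈ Finset.univ.erase i, pderiv (Sum.inl ⟨k, j k⟩) (E.monomial K k) := by
  rw [primitiveDerivation_apply, Finset.sum_eq_single i]
  · simp
  · intro k _ hk
    rw [pderiv_X_of_ne, mul_zero]
    rintro h
    simp only [Sum.inl.injEq, Sigma.mk.injEq] at h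
    exact hk h.1.symm
  · simp

theorem primitiveDerivation_X_eq_zero (v : E.Var) (hv : ∀ i, v ≠ Sum.inl ⟨i, j i⟩) :
    E.primitiveDerivation K j (X v) = 0 := by
  rw [primitiveDerivation_apply]
  refine Finset.sum_eq_zero fun i _ => ?_
  rw [pderiv_X_of_ne (hv i), mul_zero]

theorem primitiveDerivation_cofactor (i : Fin N) :
    E.primitiveDerivation K j (E.cofactor K i (j i)) = 0 := by
  rw [primitiveDerivation_apply]
  refine Finset.sum_eq_zero fun k _ => ?_
  rw [pderiv_cofactor, mul_zero]
  intro j' h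
  simp only [Sum.inl.injEq, Sigma.mk.injEq] at h
  obtain ⟨rfl, h⟩ := h
  exact (eq_of_heq h).symm

/-- For `i ≠ b` the chosen variable has exponent one, so the partial derivative of the monomial is
its cofactor, which `d` kills. Hence `d` sends the chosen variable of block `b` to a constant, and
sends the other chosen variables to products of constants and powers of that variable. -/
theorem isLND_primitiveDerivation (b : Fin N) (hj : ∀ i, i ≠ b → E.l i (j i) = 1) :
    IsLND (E.primitiveDerivation K j) := by
  set d := E.primitiveDerivation K j with hd
  have hconst (i : Fin N) (hi : i ≠ b) :
      pderiv (Sum.inl ⟨i, j i⟩) (E.monomial K i) ∈ d.constants := by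
    rw [pderiv_monomial_self, hj i hi]
    simpa [Derivation.mem_constants] using E.primitiveDerivation_cofactor j i
  have hb : d.IsNilAt (X (Sum.inl ⟨b, j b⟩)) := by
    apply Derivation.isNilAt_of_apply
    rw [hd, primitiveDerivation_X]
    refine d.constants_le_nilSubalgebra (Subalgebra.prod_mem _ fun k hk => ?_)
    exact hconst k (Finset.ne_of_mem_erase hk)
  have hnil (i : Fin N) : pderiv (Sum.inl ⟨i, j i⟩) (E.monomial K i) ∈ d.nilSubalgebra := by
    by_cases hi : i = b
    · subst hi
      rw [pderiv_monomial_self]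
      refine mul_mem (mul_mem (natCast_mem _ _) (pow_mem hb _))
        (d.constants_le_nilSubalgebra (E.primitiveDerivation_cofactor j i))
    · exact d.constants_le_nilSubalgebra (hconst i hi)
  refine isLND_of_isNilAt_X fun v => ?_
  by_cases hv : ∃ i, v = Sum.inl ⟨i, j i⟩
  · obtain ⟨i, rfl⟩ := hv
    apply Derivation.isNilAt_of_apply
    rw [hd, primitiveDerivation_X]
    exact Subalgebra.prod_mem _ fun k _ => hnil k
  · push Not at hv
    exact Derivation.isNilAt_of_apply_eq_zero (E.primitiveDerivation_X_eq_zero j v hv)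

variable [CharZero K]

theorem pderiv_monomial_dvd (i : Fin N) (j : Fin (E.n i)) :
    pderiv (Sum.inl ⟨i, j⟩) (E.monomial K i) ∣ E.monomial K i := by
  have hl : (E.l i j : K) ≠ 0 := by exact_mod_cast (E.l_pos i j).ne'
  refine ⟨C (E.l i j : K)⁻¹ * X (Sum.inl ⟨i, j⟩), ?_⟩
  rw [pderiv_monomial_self, E.monomial_eq i j]
  obtain ⟨l, hl'⟩ : ∃ l, E.l i j = l + 1 := ⟨E.l i j - 1, by have := E.l_pos i j; omega⟩
  have h1 : (E.l i j : MvPolynomial E.Var K) * C (E.l i j : K)⁻¹ = 1 := by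
    rw [← map_natCast (C : K →+* MvPolynomial E.Var K), ← C_mul, mul_inv_cancel₀ hl, C_1]
  calc _ = (E.l i j : MvPolynomial E.Var K) * C (E.l i j : K)⁻¹ * X (Sum.inl ⟨i, j⟩) ^ E.l i j *
        E.cofactor K i j := by rw [h1, one_mul]
    _ = _ := by rw [hl', Nat.add_sub_cancel, pow_succ]; ring

end TrinomialExponents

/-! ### Type A: free variables, and Type 1 with enough exponents equal to one -/

namespace TrinomialDataTwo

variable {K : Type*} [Field K] [CharZero K] (D : TrinomialDataTwo K)

theorem isOfTypeA (hm : 0 < D.E.m) : IsOfTypeA K D.R := by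
  refine isOfTypeA_of_pderiv_eq_zero (Sum.inr ⟨0, hm⟩) ?_
  rintro _ ⟨i, hi, rfl⟩
  have h1 (k) : MvPolynomial.pderiv (Sum.inr ⟨0, hm⟩) (D.E.monomial K k) = 0 :=
    D.E.pderiv_monomial_eq_zero k _ (by simp)
  simp [g, Matrix.det_fin_three, h1]

end TrinomialDataTwo

namespace TrinomialDataOne

variable {K : Type*} [Field K] [CharZero K] (D : TrinomialDataOne K)

theorem isOfTypeA_of_pos (hm : 0 < D.E.m) : IsOfTypeA K D.R := by
  refine isOfTypeA_of_pderiv_eq_zero (Sum.inr ⟨0, hm⟩) ?_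
  rintro _ ⟨i, hi, rfl⟩
  have h1 (k) : MvPolynomial.pderiv (Sum.inr ⟨0, hm⟩) (D.E.monomial K k) = 0 :=
    D.E.pderiv_monomial_eq_zero k _ (by simp)
  simp [g, h1]

omit [CharZero K] in
theorem mk_monomial (i : Fin D.r) :
    Ideal.Quotient.mk D.ideal (D.E.monomial K i) =
      Ideal.Quotient.mk D.ideal (D.E.monomial K ⟨0, D.r_pos⟩ + MvPolynomial.C (D.a ⟨0, D.r_pos⟩)
        - MvPolynomial.C (D.a i)) := by
  obtain ⟨i, hi⟩ := i
  induction i with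
  | zero => simp
  | succ i ih =>
    have h : Ideal.Quotient.mk D.ideal (D.g i hi) = 0 :=
      Ideal.Quotient.eq_zero_iff_mem.2 (Ideal.subset_span ⟨i, hi, rfl⟩)
    have h1 := ih (by omega)
    simp only [g, map_sub, map_add] at h h1 ⊢
    linear_combination h1 - h

/-- The primitive derivation maps all monomials to the same element, so it kills the differences in
the relations and descends to `R`. Its values on the chosen variables generate the unit ideal. -/
theorem isOfTypeA_of_exists (b : Fin D.r) (hb : ∀ i, i ≠ b → ∃ j, D.E.l i j = 1) :
    IsOfTypeA K D.R := by
  have hj : ∃ j : ∀ i, Fin (D.E.n i), ∀ i, i ≠ b → D.E.l i (j i) = 1 := by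
    classical
    have (i : Fin D.r) : ∃ j : Fin (D.E.n i), i ≠ b → D.E.l i j = 1 := by
      by_cases hi : i = b
      · exact ⟨⟨0, D.E.n_pos i⟩, fun h => absurd hi h⟩
      · obtain ⟨j, hj⟩ := hb i hi
        exact ⟨j, fun _ => hj⟩
    exact Classical.axiomOfChoice this
  obtain ⟨j, hj⟩ := hj
  obtain ⟨d, hd, h⟩ := exists_isLND_quotient (D.E.isLND_primitiveDerivation (K := K) j b hj)
    (S := {f | ∃ (i : ℕ) (hi : i + 1 < D.r), f = D.g i hi}) (by
      rintro _ ⟨i, hi, rfl⟩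
      simp [g, TrinomialExponents.primitiveDerivation_monomial])
  apply isOfTypeA_of_span_eq_top
  set J := Ideal.span {f : D.R | ∃ d : Derivation K D.R D.R, IsLND d ∧ ∃ b, d b = f} with hJ
  set t : D.R := Ideal.Quotient.mk D.ideal (D.E.monomial K ⟨0, D.r_pos⟩ +
    MvPolynomial.C (D.a ⟨0, D.r_pos⟩)) with ht
  have hmk (k : Fin D.r) : Ideal.Quotient.mk D.ideal (D.E.monomial K k) =
      t - algebraMap K D.R (D.a k) := by
    rw [mk_monomial, map_sub]; rfl
  have hprod (i : Fin D.r) : ∏ k ∈ Finset.univ.erase i, (t - algebraMap K D.R (D.a k)) ∈ J := by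
    refine J.mem_of_dvd (a := d (Ideal.Quotient.mk _ (MvPolynomial.X (Sum.inl ⟨i, j i⟩)))) ?_
      (Ideal.subset_span ⟨d, hd, _, rfl⟩)
    rw [h, TrinomialExponents.primitiveDerivation_X, map_prod]
    refine Finset.prod_dvd_prod_of_dvd _ _ fun k _ => ?_
    rw [← hmk]
    exact map_dvd _ (D.E.pderiv_monomial_dvd k (j k))
  -- The Lagrange basis polynomials at the distinct nodes `a i` sum to 1; evaluated at `t`, each is
  -- a scalar times a product in `J`.
  have hsum := congr_arg (Polynomial.aeval t) (Lagrange.sum_basis (s := Finset.univ) (v := D.a)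
    D.a_injective.injOn ⟨⟨0, D.r_pos⟩, Finset.mem_univ _⟩)
  rw [map_sum, map_one] at hsum
  rw [Ideal.eq_top_iff_one, ← hsum]
  refine sum_mem fun i _ => ?_
  simp only [Lagrange.basis, Lagrange.basisDivisor, Finset.prod_mul_distrib, map_mul, map_prod,
    map_sub, Polynomial.aeval_X, Polynomial.aeval_C]
  exact J.mul_mem_left _ (hprod i)

end TrinomialDataOne

/-! ### The orbit of a point under a derivation, as a formal power series -/

section Exponential

open PowerSeries

variable {K : Type*} [Field K] {C : Type*} [CommRing C] [Algebra K C]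

namespace Derivation

variable (D : Derivation K C C) (φ : C →ₐ[K] K)

/-- The power series `∑ φ(Dⁿ f) sⁿ / n!`. -/
noncomputable def expSeriesFun (f : C) : K⟦X⟧ :=
  PowerSeries.mk fun n => φ ((⇑D)^[n] f) / (n.factorial : K)

theorem coeff_expSeriesFun (f : C) (n : ℕ) :
    coeff n (D.expSeriesFun φ f) = φ ((⇑D)^[n] f) / (n.factorial : K) := coeff_mk _ _

theorem expSeriesFun_add (f g : C) :
    D.expSeriesFun φ (f + g) = D.expSeriesFun φ f + D.expSeriesFun φ g := by
  ext n
  simp [coeff_expSeriesFun, D.iterate_add_apply, add_div]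

variable [CharZero K]

theorem derivative_expSeriesFun (f : C) :
    derivative K (D.expSeriesFun φ f) = D.expSeriesFun φ (D f) := by
  ext n
  rw [coeff_derivative, coeff_expSeriesFun, coeff_expSeriesFun, Function.iterate_succ_apply,
    Nat.factorial_succ]
  have h1 : (n.factorial : K) ≠ 0 := by exact_mod_cast n.factorial_ne_zero
  have h2 : (n + 1 : K) ≠ 0 := by exact_mod_cast n.succ_ne_zero
  push_cast
  field_simp

/-- Formal differentiation corresponds to `D`, so both sides obey the same Leibniz rule; in
characteristic zero the coefficient of index n + 1 is determined by the n-th one of the derivative.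
-/
theorem coeff_expSeriesFun_mul (n : ℕ) (f g : C) :
    coeff n (D.expSeriesFun φ (f * g)) = coeff n (D.expSeriesFun φ f * D.expSeriesFun φ g) := by
  induction n generalizing f g with
  | zero => simp [coeff_expSeriesFun, PowerSeries.coeff_mul]
  | succ n ih =>
    have h2 : (n + 1 : K) ≠ 0 := by exact_mod_cast n.succ_ne_zero
    apply mul_right_cancel₀ h2
    rw [← coeff_derivative, ← coeff_derivative, derivative_expSeriesFun, Derivation.leibniz,
      Derivation.leibniz, expSeriesFun_add, map_add, map_add, smul_eq_mul, smul_eq_mul, ih, ih,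
      derivative_expSeriesFun, derivative_expSeriesFun, smul_eq_mul, smul_eq_mul]

/-- The homomorphism `f ↦ ∑ φ(Dⁿ f) sⁿ / n!`. -/
noncomputable def expSeries : C →ₐ[K] K⟦X⟧ where
  toFun := D.expSeriesFun φ
  map_zero' := by ext n; simp [coeff_expSeriesFun, D.iterate_zero]
  map_add' := D.expSeriesFun_add φ
  map_mul' f g := by ext n; exact D.coeff_expSeriesFun_mul φ n f g
  map_one' := by
    ext n
    rw [coeff_expSeriesFun, PowerSeries.coeff_one]
    rcases n with _ | n
    · simp
    · simp [Function.iterate_succ_apply, D.iterate_zero]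
  commutes' r := by
    ext n
    rw [coeff_expSeriesFun, PowerSeries.algebraMap_apply, PowerSeries.coeff_C]
    rcases n with _ | n
    · simp
    · simp [Function.iterate_succ_apply, D.iterate_zero]

theorem coeff_expSeries (f : C) (n : ℕ) :
    coeff n (D.expSeries φ f) = φ ((⇑D)^[n] f) / (n.factorial : K) := coeff_expSeriesFun D φ f n

theorem IsNilAt.exists_polynomial {D : Derivation K C C} {f : C} (h : D.IsNilAt f) :
    ∃ p : K[X], (p : K⟦X⟧) = D.expSeries φ f := by
  obtain ⟨k, hk⟩ := h
  refine ⟨PowerSeries.trunc k (D.expSeries φ f), ?_⟩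
  ext n
  rw [Polynomial.coeff_coe, PowerSeries.coeff_trunc]
  split_ifs with hn
  · rfl
  · rw [coeff_expSeries, D.iterate_eq_zero_of_le hk (not_lt.1 hn)]
    simp

end Derivation

end Exponential

/-! ### A Mason–Stothers type argument -/

section PowerfulProducts

open Polynomial

variable {K : Type*} [Field K]

theorem prod_pow_pred_dvd_derivative {ι : Type*} (s : Finset ι) (p : ι → K[X]) (l : ι → ℕ) :
    ∏ j ∈ s, p j ^ (l j - 1) ∣ derivative (∏ j ∈ s, p j ^ l j) := by
  classical
  induction s using Finset.induction_on with
  | empty => simp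
  | insert i s hi ih =>
    rw [Finset.prod_insert hi, Finset.prod_insert hi, derivative_mul, derivative_pow]
    refine dvd_add (mul_dvd_mul ?_ ?_) (mul_dvd_mul (pow_dvd_pow _ (Nat.sub_le _ _)) ih)
    · rw [mul_right_comm]
      exact dvd_mul_left _ _
    · exact Finset.prod_dvd_prod_of_dvd _ _ fun j _ => pow_dvd_pow _ (Nat.sub_le _ _)

/-- `A` and `B` are coprime of equal degree and have the same derivative, which is therefore
divisible by `G * H`. Each of `G`, `H` has at least half the degree of `A`, too much for a nonzero
derivative. -/
theorem derivative_eq_zero_of_sub_eq_C {A B G H : K[X]} {c : K} (hc : c ≠ 0) (hAB : A - B = C c)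
    (hG : G ∣ A) (hG' : G ∣ derivative A) (hAG : A ∣ G ^ 2)
    (hH : H ∣ B) (hH' : H ∣ derivative B) (hBH : B ∣ H ^ 2) : derivative A = 0 := by
  by_contra h
  have hB' : derivative B = derivative A := by
    have := congr_arg derivative hAB
    rw [derivative_sub, derivative_C] at this
    exact (sub_eq_zero.1 this).symm
  have hA0 : A ≠ 0 := by rintro rfl; simp at h
  have hB0 : B ≠ 0 := by rintro rfl; simp [← hB'] at h
  have hG0 : G ≠ 0 := ne_zero_of_dvd_ne_zero hA0 hG
  have hH0 : H ≠ 0 := ne_zero_of_dvd_ne_zero hB0 hH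
  have hcop : IsCoprime A B := by
    refine ⟨C c⁻¹, -C c⁻¹, ?_⟩
    have : C c⁻¹ * (A - B) = 1 := by rw [hAB, ← C_mul, inv_mul_cancel₀ hc, C_1]
    linear_combination this
  have hGH : G * H ∣ derivative A :=
    ((hcop.of_isCoprime_of_dvd_left hG).of_isCoprime_of_dvd_right hH).mul_dvd hG' (hB' ▸ hH')
  have h1 := natDegree_le_of_dvd hGH h
  rw [natDegree_mul hG0 hH0] at h1
  have hA1 : A.natDegree ≠ 0 := fun h0 => h (by rw [eq_C_of_natDegree_eq_zero h0, derivative_C])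
  have h2 := natDegree_derivative_lt hA1
  have h3 := natDegree_le_of_dvd hAG (pow_ne_zero 2 hG0)
  have h4 := natDegree_le_of_dvd hBH (pow_ne_zero 2 hH0)
  have h5 : B.natDegree = A.natDegree := by
    rw [← natDegree_sub_C (p := A) (a := c), ← hAB, sub_sub_cancel]
  rw [natDegree_pow] at h3 h4
  omega

theorem derivative_prod_eq_zero_of_sub_eq_C {ι κ : Type*} [Fintype ι] [Fintype κ] (p : ι → K[X])
    (q : κ → K[X]) {l : ι → ℕ} {k : κ → ℕ} (hl : ∀ i, 2 ≤ l i) (hk : ∀ i, 2 ≤ k i) {c : K}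
    (hc : c ≠ 0) (h : ∏ i, p i ^ l i - ∏ i, q i ^ k i = C c) :
    derivative (∏ i, p i ^ l i) = 0 := by
  refine derivative_eq_zero_of_sub_eq_C (G := ∏ i, p i ^ (l i - 1)) (H := ∏ i, q i ^ (k i - 1))
    hc h ?_ (prod_pow_pred_dvd_derivative _ _ _) ?_ ?_ (prod_pow_pred_dvd_derivative _ _ _) ?_
  · exact Finset.prod_dvd_prod_of_dvd _ _ fun j _ => pow_dvd_pow _ (Nat.sub_le _ _)
  · rw [← Finset.prod_pow]
    refine Finset.prod_dvd_prod_of_dvd _ _ fun j _ => ?_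
    rw [← pow_mul]
    -- l ≤ 2 (l - 1) is exactly the hypothesis 2 ≤ l.
    exact pow_dvd_pow _ (by have := hl j; omega)
  · exact Finset.prod_dvd_prod_of_dvd _ _ fun j _ => pow_dvd_pow _ (Nat.sub_le _ _)
  · rw [← Finset.prod_pow]
    refine Finset.prod_dvd_prod_of_dvd _ _ fun j _ => ?_
    rw [← pow_mul]
    exact pow_dvd_pow _ (by have := hk j; omega)

end PowerfulProducts

/-! ### Orbits on varieties of Type 1 -/

namespace TrinomialDataOne

open Polynomial

variable {K : Type*} [Field K] [CharZero K] (D : TrinomialDataOne K)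

/-- The class of a variable in `R(A)`. -/
noncomputable abbrev coord (v : D.E.Var) : D.R := Ideal.Quotient.mk D.ideal (MvPolynomial.X v)

/-- Along the orbit of the point `φ` the coordinates are polynomials. The monomials `i₁` and `i₂`
differ by a nonzero constant, so they are constant, and then so is every monomial. Being nonzero, it
has only unit factors; the linear coefficient of such a factor is the required value. -/
theorem apply_isLND_coord_eq_zero {d : Derivation K D.R D.R} (hd : IsLND d) (φ : D.R →ₐ[K] K)
    (hφ : ∀ v, φ (D.coord v) ≠ 0) {i₁ i₂ : Fin D.r} (hi : i₁ ≠ i₂) (h₁ : ∀ j, 2 ≤ D.E.l i₁ j)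
    (h₂ : ∀ j, 2 ≤ D.E.l i₂ j) (i : Fin D.r) (j : Fin (D.E.n i)) :
    φ (d (D.coord (Sum.inl ⟨i, j⟩))) = 0 := by
  choose p hp using fun v => (show d.IsNilAt (D.coord v) from hd _).exists_polynomial φ
  set M : Fin D.r → K[X] := fun i => ∏ j, p (Sum.inl ⟨i, j⟩) ^ D.E.l i j with hM
  have hMψ (i) : (M i : PowerSeries K) =
      d.expSeries φ (Ideal.Quotient.mk D.ideal (D.E.monomial K i)) := by
    simp only [hM, TrinomialExponents.monomial, map_prod, map_pow, ← hp]
    rw [← Polynomial.coeToPowerSeries.ringHom_apply, map_prod]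
    simp only [map_pow, Polynomial.coeToPowerSeries.ringHom_apply]
  have hsub (i k : Fin D.r) : M i - M k = C (D.a k - D.a i) := by
    apply Polynomial.coe_injective K
    rw [Polynomial.coe_sub, hMψ, hMψ, D.mk_monomial i, D.mk_monomial k, ← map_sub, ← map_sub,
      sub_sub_sub_cancel_left, ← MvPolynomial.C_sub, Polynomial.coe_C]
    exact (d.expSeries φ).commutes _
  have hd1 : derivative (M i₁) = 0 :=
    derivative_prod_eq_zero_of_sub_eq_C _ _ h₁ h₂
      (sub_ne_zero.2 (D.a_injective.ne hi.symm)) (hsub i₁ i₂)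
  have hd2 : derivative (M i) = 0 := by
    have := congr_arg derivative (hsub i i₁)
    rwa [derivative_sub, hd1, derivative_C, sub_zero] at this
  have hconst := eq_C_of_natDegree_eq_zero (derivative_eq_zero.1 hd2)
  have h0 (v) : (p v).coeff 0 ≠ 0 := by
    rw [← Polynomial.coeff_coe, hp, Derivation.coeff_expSeries]
    simpa using hφ v
  have hunit : IsUnit (M i) := by
    rw [hconst, isUnit_C, isUnit_iff_ne_zero, coeff_zero_eq_eval_zero, hM]
    simp only [eval_prod, eval_pow, ← coeff_zero_eq_eval_zero]
    exact Finset.prod_ne_zero_iff.2 fun j _ => pow_ne_zero _ (h0 _)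
  have hpu : IsUnit (p (Sum.inl ⟨i, j⟩)) := by
    refine isUnit_of_dvd_unit ((dvd_pow_self _ (D.E.l_pos i j).ne').trans ?_) hunit
    exact Finset.dvd_prod_of_mem (fun j => p (Sum.inl ⟨i, j⟩) ^ D.E.l i j) (Finset.mem_univ j)
  have h1 : (p (Sum.inl ⟨i, j⟩)).coeff 1 = 0 :=
    coeff_eq_zero_of_natDegree_lt (by rw [natDegree_eq_zero_of_isUnit hpu]; exact one_pos)
  rw [← Polynomial.coeff_coe, hp, Derivation.coeff_expSeries] at h1
  simpa using h1

end TrinomialDataOne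

/-! ### Separating exponent vectors by torus characters -/

section Characters

variable {σ : Type*} [Fintype σ] {K : Type*} [Field K]

/-- The character of the torus `(Kˣ)^σ` with weight `e`. -/
def torusChar (K : Type*) [Field K] (e : σ →₀ ℕ) : (σ → Kˣ) →* Kˣ where
  toFun h := ∏ v, h v ^ e v
  map_one' := by simp
  map_mul' h h' := by simp [mul_pow, Finset.prod_mul_distrib]

theorem torusChar_apply (e : σ →₀ ℕ) (h : σ → Kˣ) : torusChar K e h = ∏ v, h v ^ e v := rfl

theorem torusChar_mulSingle [DecidableEq σ] (e : σ →₀ ℕ) (v : σ) (a : Kˣ) :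
    torusChar K e (Pi.mulSingle v a) = a ^ e v := by
  rw [torusChar_apply, Finset.prod_eq_single v]
  · simp
  · intro w _ hw
    simp [Pi.mulSingle_eq_of_ne hw]
  · simp

variable [IsAlgClosed K] [CharZero K]

/-- Two weights `e`, `e'` that are not divisible by a monomial `λ` and define the same character of
`{h | h^λ = 1}` agree on the support of `λ`. -/
theorem eqOn_support_of_torusChar_eq [DecidableEq σ] {lam e e' : σ →₀ ℕ}
    (he : ¬ lam ≤ e) (he' : ¬ lam ≤ e')
    (h : ∀ v ∈ lam.support, ∀ w ∈ lam.support, ∀ a b : Kˣ, a ^ lam v * b ^ lam w = 1 →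
      a ^ e v * b ^ e w = a ^ e' v * b ^ e' w) :
    ∀ v ∈ lam.support, e v = e' v := by
  by_contra hne
  push Not at hne
  obtain ⟨v, hv, hvne⟩ := hne
  wlog hlt : e' v < e v generalizing e e'
  · exact this he' he (fun v hv w hw a b hab => (h v hv w hw a b hab).symm) hvne.symm (by omega)
  have hgt : ∀ w ∈ lam.support, e' w < e w := by
    intro w hw
    -- Since 2 has infinite order in characteristic zero, testing on (u^(λ_w), u^(-λ_v)) shows that
    -- e - e' is proportional to λ on {v, w}; its sign at v is thus its sign at w.
    set u : Kˣ := Units.mk0 2 two_ne_zero with hu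
    have h1 := h v hv w hw (u ^ lam w) (u⁻¹ ^ lam v) (by
      rw [← pow_mul, ← pow_mul, inv_pow, mul_comm (lam v), mul_inv_cancel])
    rw [← pow_mul, ← pow_mul, ← pow_mul, ← pow_mul, inv_pow, inv_pow, mul_inv_eq_iff_eq_mul,
      mul_right_comm, eq_mul_inv_iff_mul_eq, ← pow_add, ← pow_add] at h1
    have h2 : (2 : K) ^ (lam w * e v + lam v * e' w) = 2 ^ (lam w * e' v + lam v * e w) := by
      simpa [hu] using congr_arg (Units.val) h1
    have h3 : lam w * e v + lam v * e' w = lam w * e' v + lam v * e w := by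
      have : (2 ^ (lam w * e v + lam v * e' w) : ℕ) = 2 ^ (lam w * e' v + lam v * e w) := by
        exact_mod_cast h2
      exact Nat.pow_right_injective le_rfl this
    have hw0 : 0 < lam w := Nat.pos_of_ne_zero (Finsupp.mem_support_iff.1 hw)
    by_contra hle
    push Not at hle
    have h4 : lam v * e w ≤ lam v * e' w := Nat.mul_le_mul_left _ hle
    have h5 : lam w * e' v < lam w * e v := Nat.mul_lt_mul_of_pos_left hlt hw0
    omega
  obtain ⟨w, hw⟩ : ∃ w, e w < lam w := by
    by_contra hall
    push Not at hall
    exact he hall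
  have hw' : w ∈ lam.support := Finsupp.mem_support_iff.2 (by omega)
  have := hgt w hw'
  have : NeZero (lam w : K) := ⟨by exact_mod_cast (by omega : lam w ≠ 0)⟩
  -- Now e' w < e w < λ w, and a primitive root of unity of order λ w distinguishes two exponents
  -- below λ w.
  obtain ⟨ζ, hζ⟩ := HasEnoughRootsOfUnity.exists_primitiveRoot K (lam w)
  have hζ0 : ζ ≠ 0 := hζ.ne_zero (by omega)
  have h1 := h w hw' w hw' (Units.mk0 ζ hζ0) 1 (by
    rw [one_pow, mul_one]
    ext
    simpa using hζ.pow_eq_one)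
  have h2 : ζ ^ e w = ζ ^ e' w := by simpa using congr_arg Units.val h1
  have := hζ.pow_inj (by omega) (by omega) h2
  omega

end Characters

/-! ### Points with nonzero coordinates detect zero; rigidity in Type 1 -/

section VanishingOnPoints

open MvPolynomial

namespace TrinomialExponents

variable {N : ℕ} (E : TrinomialExponents N)

/-- The exponent vector of `Tᵢ^{lᵢ}`. -/
noncomputable def blockExp (i : Fin N) : E.Var →₀ ℕ :=
  Finsupp.equivFunOnFinite.symm
    (Sum.elim (fun p => if p.1 = i then E.l p.1 p.2 else 0) fun _ => 0)

theorem blockExp_inl (i i' : Fin N) (j : Fin (E.n i')) :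
    E.blockExp i (Sum.inl ⟨i', j⟩) = if i' = i then E.l i' j else 0 := rfl

theorem blockExp_inl_self (i : Fin N) (j : Fin (E.n i)) :
    E.blockExp i (Sum.inl ⟨i, j⟩) = E.l i j := by simp [blockExp_inl]

theorem prod_pow_blockExp {M : Type*} [CommMonoid M] (i : Fin N) (x : E.Var → M) :
    ∏ v, x v ^ E.blockExp i v = ∏ j, x (Sum.inl ⟨i, j⟩) ^ E.l i j := by
  rw [Fintype.prod_sum_type, Fintype.prod_sigma, Finset.prod_eq_single i]
  · simp [blockExp]
  · intro i' _ hi'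
    simp [blockExp, hi']
  · simp

theorem mem_support_blockExp {i : Fin N} {v : E.Var} :
    v ∈ (E.blockExp i).support ↔ ∃ j, v = Sum.inl ⟨i, j⟩ := by
  rw [Finsupp.mem_support_iff]
  rcases v with ⟨i', j⟩ | k
  · rw [blockExp_inl]
    constructor
    · intro h
      have : i' = i := by by_contra hne; simp [hne] at h
      subst this
      exact ⟨j, rfl⟩
    · rintro ⟨j', h⟩
      simp only [Sum.inl.injEq, Sigma.mk.injEq] at h
      simpa [h.1] using (E.l_pos i' j).ne'
  · simp [blockExp]

theorem monomial_eq_monomial (K : Type*) [Field K] (i : Fin N) :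
    E.monomial K i = MvPolynomial.monomial (E.blockExp i) 1 := by
  rw [MvPolynomial.monomial_eq, Finsupp.prod_fintype _ _ (by simp), E.prod_pow_blockExp i]
  simp [monomial]

/-- The total degree in the variables of the blocks other than the `o`-th one. -/
def offDegree (o : Fin N) (e : E.Var →₀ ℕ) : ℕ :=
  ∑ p : Σ i : Fin N, Fin (E.n i), if p.1 = o then 0 else e (Sum.inl p)

theorem offDegree_add (o : Fin N) (e e' : E.Var →₀ ℕ) :
    E.offDegree o (e + e') = E.offDegree o e + E.offDegree o e' := by
  rw [offDegree, offDegree, offDegree, ← Finset.sum_add_distrib]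
  refine Finset.sum_congr rfl fun p _ => ?_
  split_ifs <;> simp

theorem offDegree_blockExp_self (o : Fin N) : E.offDegree o (E.blockExp o) = 0 := by
  refine Finset.sum_eq_zero fun p _ => ?_
  split_ifs with h
  · rfl
  · obtain ⟨i, j⟩ := p
    rw [blockExp_inl, if_neg h]

theorem offDegree_blockExp_pos {o i : Fin N} (hi : i ≠ o) : 0 < E.offDegree o (E.blockExp i) := by
  refine Finset.sum_pos' (fun _ _ => Nat.zero_le _) ⟨⟨i, ⟨0, E.n_pos i⟩⟩, Finset.mem_univ _, ?_⟩
  rw [if_neg hi, blockExp_inl_self]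
  exact E.l_pos _ _

/-- The exponent vectors not divisible by a monomial `Tᵢ^{lᵢ}` with `i ≠ o`. -/
def reducedExps (o : Fin N) : Set (E.Var →₀ ℕ) := {e | ∀ i, i ≠ o → ¬ E.blockExp i ≤ e}

end TrinomialExponents

namespace TrinomialDataOne

variable {K : Type*} [Field K] (D : TrinomialDataOne K)

/-- The index of the first monomial. -/
abbrev o : Fin D.r := ⟨0, D.r_pos⟩

/-- Rewriting T_i^{l_i} as T_o^{l_o} + (a_o - a_i) strictly lowers the degree in the variables
outside block `o`, so the reduction terminates. -/
theorem exists_reduced_monomial (e : D.E.Var →₀ ℕ) :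
    ∃ G ∈ restrictSupport K (D.E.reducedExps D.o),
      Ideal.Quotient.mk D.ideal (monomial e 1) = Ideal.Quotient.mk D.ideal G := by
  induction hn : D.E.offDegree D.o e using Nat.strong_induction_on generalizing e with
  | _ n ih =>
    by_cases he : e ∈ D.E.reducedExps D.o
    · exact ⟨_, (monomial_mem_restrictSupport K).2 (Or.inl he), rfl⟩
    · simp only [TrinomialExponents.reducedExps, Set.mem_ofPred_eq, not_forall, not_not] at he
      obtain ⟨i, hi, hle⟩ := he
      obtain ⟨f, rfl⟩ := exists_add_of_le hle
      have hpos := D.E.offDegree_blockExp_pos hi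
      rw [TrinomialExponents.offDegree_add] at hn
      obtain ⟨G₁, hG₁, h₁⟩ := ih _ (by
        rw [TrinomialExponents.offDegree_add, TrinomialExponents.offDegree_blockExp_self]
        omega) (D.E.blockExp D.o + f) rfl
      obtain ⟨G₂, hG₂, h₂⟩ := ih _ (by omega) f rfl
      refine ⟨G₁ + (D.a D.o - D.a i) • G₂, add_mem hG₁ (Submodule.smul_mem _ _ hG₂), ?_⟩
      have hmul (k : Fin D.r) : (monomial (D.E.blockExp k + f) (1 : K)) =
          D.E.monomial K k * monomial f 1 := by
        rw [D.E.monomial_eq_monomial, monomial_mul, one_mul]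
      rw [smul_eq_C_mul, map_add, map_mul, ← h₁, ← h₂, hmul, hmul, map_mul, map_mul,
        D.mk_monomial i, C_sub]
      simp only [map_add, map_sub]
      ring

theorem exists_reduced (F : MvPolynomial D.E.Var K) :
    ∃ G ∈ restrictSupport K (D.E.reducedExps D.o),
      Ideal.Quotient.mk D.ideal F = Ideal.Quotient.mk D.ideal G := by
  induction F using MvPolynomial.induction_on' with
  | monomial e a =>
    obtain ⟨G, hG, h⟩ := D.exists_reduced_monomial e
    refine ⟨a • G, Submodule.smul_mem _ _ hG, ?_⟩
    rw [smul_eq_C_mul, map_mul, ← h, ← map_mul, C_mul_monomial, mul_one]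
  | add p q hp hq =>
    obtain ⟨G, hG, h⟩ := hp
    obtain ⟨G', hG', h'⟩ := hq
    exact ⟨G + G', add_mem hG hG', by rw [map_add, map_add, h, h']⟩

/-- The points of the variety all of whose coordinates are nonzero. -/
def torusPoints : Set (D.E.Var → K) :=
  {x | (∀ v, x v ≠ 0) ∧
    ∀ i, ∏ v, x v ^ D.E.blockExp i v + D.a i = ∏ v, x v ^ D.E.blockExp D.o v + D.a D.o}

variable {D}

/-- The homomorphism of evaluation at a point. -/
noncomputable def evalAt {x : D.E.Var → K} (hx : x ∈ D.torusPoints) : D.R →ₐ[K] K :=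
  Ideal.Quotient.liftₐ D.ideal (aeval x) (by
    intro f hf
    rw [ideal, Ideal.mem_span] at hf
    refine RingHom.mem_ker.1 (hf (RingHom.ker (aeval x)) ?_)
    rintro _ ⟨i, hi, rfl⟩
    have h1 := hx.2 ⟨i, by omega⟩
    have h2 := hx.2 ⟨i + 1, hi⟩
    simp only [TrinomialExponents.prod_pow_blockExp] at h1 h2
    simp only [SetLike.mem_coe, RingHom.mem_ker, g, TrinomialExponents.monomial, map_sub, map_prod,
      map_pow, aeval_X, algHom_C, Algebra.algebraMap_self, RingHom.id_apply]
    linear_combination h1 - h2)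

theorem evalAt_mk {x : D.E.Var → K} (hx : x ∈ D.torusPoints) (F : MvPolynomial D.E.Var K) :
    evalAt hx (Ideal.Quotient.mk D.ideal F) = eval x F := by
  change aeval x F = eval x F
  rw [← coe_aeval_eq_eval]
  rfl

variable (D) in
/-- The variables of the blocks other than the first one. -/
def offVars : Set D.E.Var := {v | ∃ i, i ≠ D.o ∧ v ∈ (D.E.blockExp i).support}

variable (D) in
/-- The subgroup of the torus acting on the variety and fixing the variables outside `offVars`. -/
def torusStabilizer : Subgroup (D.E.Var → Kˣ) where
  carrier := {h | (∀ v, v ∉ D.offVars → h v = 1) ∧ ∀ i, torusChar K (D.E.blockExp i) h = 1}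
  mul_mem' := by
    rintro a b ⟨ha, ha'⟩ ⟨hb, hb'⟩
    exact ⟨fun v hv => by simp [ha v hv, hb v hv], fun i => by rw [map_mul, ha', hb', one_mul]⟩
  one_mem' := ⟨fun _ _ => rfl, fun _ => map_one _⟩
  inv_mem' := by
    rintro a ⟨ha, ha'⟩
    exact ⟨fun v hv => by simp [ha v hv], fun i => by rw [map_inv, ha', inv_one]⟩

theorem mul_mem_torusPoints {x : D.E.Var → K} (hx : x ∈ D.torusPoints) {h : D.E.Var → Kˣ}
    (hh : h ∈ D.torusStabilizer) : (fun v => x v * h v) ∈ D.torusPoints := by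
  have h1 (i) : ∏ v, (h v : K) ^ D.E.blockExp i v = 1 := by
    simpa [torusChar_apply] using congr_arg Units.val (hh.2 i)
  refine ⟨fun v => mul_ne_zero (hx.1 v) (h v).ne_zero, fun i => ?_⟩
  simp only [mul_pow, Finset.prod_mul_distrib, h1, mul_one]
  exact hx.2 i

variable (D) in
/-- The restriction of a torus character to `torusStabilizer`. -/
def stabChar (e : D.E.Var →₀ ℕ) : D.torusStabilizer →* K :=
  (Units.coeHom K).comp ((torusChar K e).comp D.torusStabilizer.subtype)

theorem stabChar_apply (e : D.E.Var →₀ ℕ) (h : D.torusStabilizer) :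
    D.stabChar e h = ∏ v, (h.1 v : K) ^ e v := by
  simp [stabChar, torusChar_apply]

section

variable [IsAlgClosed K] [CharZero K]

theorem eqOn_offVars_of_stabChar_eq {e e' : D.E.Var →₀ ℕ} (he : e ∈ D.E.reducedExps D.o)
    (he' : e' ∈ D.E.reducedExps D.o) (h : D.stabChar e = D.stabChar e') :
    ∀ v ∈ D.offVars, e v = e' v := by
  classical
  rintro v ⟨i, hi, hv⟩
  refine eqOn_support_of_torusChar_eq (K := K) (he i hi) (he' i hi) ?_ v hv
  intro v hv w hw a b hab
  have key : (Pi.mulSingle v a * Pi.mulSingle w b : D.E.Var → Kˣ) ∈ D.torusStabilizer := by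
    refine ⟨fun u hu => ?_, fun k => ?_⟩
    · have h1 : u ≠ v := by rintro rfl; exact hu ⟨i, hi, hv⟩
      have h2 : u ≠ w := by rintro rfl; exact hu ⟨i, hi, hw⟩
      simp [Pi.mulSingle_eq_of_ne h1, Pi.mulSingle_eq_of_ne h2]
    · rw [map_mul, torusChar_mulSingle, torusChar_mulSingle]
      by_cases hk : k = i
      · rw [hk, hab]
      · have hz : ∀ v ∈ (D.E.blockExp i).support, D.E.blockExp k v = 0 := by
          intro v hv
          obtain ⟨j, rfl⟩ := D.E.mem_support_blockExp.1 hv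
          rw [D.E.blockExp_inl, if_neg (Ne.symm hk)]
        rw [hz v hv, hz w hw, pow_zero, pow_zero, one_mul]
  have h1 := DFunLike.congr_fun h ⟨_, key⟩
  have h2 := Units.ext h1
  simpa [torusChar_mulSingle] using h2

/-- The values on block `o` prescribe the values of all other monomials; nonzero prescribed values
are attained because K is algebraically closed. -/
theorem exists_mem_torusPoints {y : D.E.Var → K} (hy : ∀ v, y v ≠ 0)
    (hy' : ∀ i, ∏ v, y v ^ D.E.blockExp D.o v + D.a D.o - D.a i ≠ 0) :
    ∃ x ∈ D.torusPoints, ∀ v, v ∉ D.offVars → x v = y v := by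
  classical
  set c : Fin D.r → K := fun i => ∏ v, y v ^ D.E.blockExp D.o v + D.a D.o - D.a i with hc
  have hroot (i : Fin D.r) : ∃ z : K, z ^ D.E.l i ⟨0, D.E.n_pos i⟩ = c i :=
    IsAlgClosed.exists_pow_nat_eq _ (D.E.l_pos _ _)
  choose z hz using hroot
  -- In each other block the first variable is a root of the prescribed value and the remaining ones
  -- are 1.
  set x : D.E.Var → K := Sum.elim
    (fun p => if p.1 = D.o then y (Sum.inl p) else if p.2.1 = 0 then z p.1 else 1)
    (fun k => y (Sum.inr k)) with hx
  have hxo (j) : x (Sum.inl ⟨D.o, j⟩) = y (Sum.inl ⟨D.o, j⟩) := by simp [hx]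
  have hprodo : ∏ v, x v ^ D.E.blockExp D.o v = ∏ v, y v ^ D.E.blockExp D.o v := by
    simp only [D.E.prod_pow_blockExp, hxo]
  refine ⟨x, ⟨?_, ?_⟩, ?_⟩
  · rintro (⟨i, j⟩ | k)
    · simp only [hx, Sum.elim_inl]
      split_ifs
      · exact hy _
      · intro h0
        have := hz i
        rw [h0, zero_pow (D.E.l_pos _ _).ne'] at this
        exact hy' i this.symm
      · exact one_ne_zero
    · exact hy _
  · intro i
    by_cases hi : i = D.o
    · rw [hi]
    · rw [hprodo, D.E.prod_pow_blockExp i, Finset.prod_eq_single ⟨0, D.E.n_pos i⟩]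
      · simp only [hx, Sum.elim_inl, if_neg hi, if_true, hz, hc]
        ring
      · intro j _ hj
        have : j.1 ≠ 0 := fun h => hj (Fin.ext h)
        simp [hx, hi, this]
      · simp
  · rintro (⟨i, j⟩ | k) hv
    · have : i = D.o := by
        by_contra hi
        exact hv ⟨i, hi, D.E.mem_support_blockExp.2 ⟨j, rfl⟩⟩
      subst this
      exact hxo j
    · rfl

/-- Independence of the characters of `torusStabilizer` splits `G` into pieces that vanish
separately. The exponents in one piece agree on `offVars`, so the piece is a monomial in those
variables times a polynomial in the others, whose values are free up to a nonvanishing condition. -/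
theorem eq_zero_of_eval_eq_zero {G : MvPolynomial D.E.Var K}
    (hG : G ∈ restrictSupport K (D.E.reducedExps D.o))
    (h : ∀ x ∈ D.torusPoints, eval x G = 0) : G = 0 := by
  classical
  rw [mem_restrictSupport_iff] at hG
  by_contra hG0
  obtain ⟨e₀, he₀⟩ := support_nonempty.2 hG0
  set S := G.support.filter fun e => D.stabChar e = D.stabChar e₀ with hS
  set G₀ : MvPolynomial D.E.Var K := ∑ e ∈ S, monomial e (coeff e G) with hG₀
  have heval (x : D.E.Var → K) : eval x G₀ = ∑ e ∈ S, coeff e G * ∏ v, x v ^ e v := by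
    simp [hG₀, eval_monomial, Finsupp.prod_fintype]
  have hvan : ∀ x ∈ D.torusPoints, eval x G₀ = 0 := by
    intro x hx
    have hli := linearIndependent_iff'.1 (linearIndependent_monoidHom D.torusStabilizer K)
      (G.support.image D.stabChar)
      (fun χ => ∑ e ∈ G.support with D.stabChar e = χ, coeff e G * ∏ v, x v ^ e v) ?_
      (D.stabChar e₀) (Finset.mem_image_of_mem _ he₀)
    · rw [heval]
      exact hli
    · ext t
      have h1 := h _ (mul_mem_torusPoints hx t.2)
      rw [eval_eq'] at h1
      rw [Finset.sum_apply, Pi.zero_apply, ← h1, ← Finset.sum_fiberwise_of_maps_to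
        (fun e he => Finset.mem_image_of_mem D.stabChar he)]
      refine Finset.sum_congr rfl fun χ _ => ?_
      rw [Pi.smul_apply, smul_eq_mul, Finset.sum_mul]
      refine Finset.sum_congr rfl fun e he => ?_
      rw [← (Finset.mem_filter.1 he).2, stabChar_apply]
      simp only [mul_pow, Finset.prod_mul_distrib]
      ring
  have hvan' : ∀ y : D.E.Var → K, (∀ v, y v ≠ 0) →
      (∀ i, ∏ v, y v ^ D.E.blockExp D.o v + D.a D.o - D.a i ≠ 0) → eval y G₀ = 0 := by
    intro y hy hy'
    obtain ⟨x, hx, hxy⟩ := exists_mem_torusPoints hy hy'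
    -- Passing from `x` to `y` changes only the variables in `offVars`, where all terms of `G₀` have
    -- the exponents of `e₀`; so it scales `G₀` by a single factor.
    have h1 : eval y G₀ = (∏ v, (y v / x v) ^ e₀ v) * eval x G₀ := by
      rw [heval, heval, Finset.mul_sum]
      refine Finset.sum_congr rfl fun e he => ?_
      have hq : ∏ v, (y v / x v) ^ e₀ v = ∏ v, (y v / x v) ^ e v := by
        refine Finset.prod_congr rfl fun v _ => ?_
        by_cases hv : v ∈ D.offVars
        · rw [eqOn_offVars_of_stabChar_eq (hG (Finset.mem_of_mem_filter e he)) (hG he₀)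
            (Finset.mem_filter.1 he).2 v hv]
        · rw [hxy v hv, div_self (hy v), one_pow, one_pow]
      rw [hq, mul_left_comm, ← Finset.prod_mul_distrib]
      congr 1
      refine Finset.prod_congr rfl fun v _ => ?_
      rw [← mul_pow, div_mul_cancel₀ _ (hx.1 v)]
    rw [h1, hvan x hx, mul_zero]
  -- The points with `Q ≠ 0` are those covered by `hvan'`.
  set Q : MvPolynomial D.E.Var K := (∏ v, X v) *
    ∏ i, (D.E.monomial K D.o + C (D.a D.o - D.a i)) with hQ
  have hQ0 : Q ≠ 0 := by
    refine mul_ne_zero (Finset.prod_ne_zero_iff.2 fun v _ => X_ne_zero v)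
      (Finset.prod_ne_zero_iff.2 fun i _ h0 => ?_)
    have h1 : coeff (D.E.blockExp D.o) (D.E.monomial K D.o + C (D.a D.o - D.a i)) = 0 := by
      rw [h0, coeff_zero]
    have h2 : (0 : D.E.Var →₀ ℕ) ≠ D.E.blockExp D.o := by
      intro h
      have := D.E.l_pos D.o ⟨0, D.E.n_pos _⟩
      rw [← D.E.blockExp_inl_self, ← h] at this
      simp at this
    rw [D.E.monomial_eq_monomial, coeff_add, coeff_monomial, if_pos rfl, coeff_C, if_neg h2] at h1
    simp at h1
  have hprod : G₀ * Q = 0 := by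
    refine MvPolynomial.funext fun y => ?_
    rw [map_mul, map_zero]
    by_cases hyQ : eval y Q = 0
    · rw [hyQ, mul_zero]
    · rw [hQ, map_mul, map_prod, map_prod, ← ne_eq, mul_ne_zero_iff, Finset.prod_ne_zero_iff,
        Finset.prod_ne_zero_iff] at hyQ
      rw [hvan' y (fun v => by simpa using hyQ.1 v (Finset.mem_univ v)) (fun i => ?_), zero_mul]
      have := hyQ.2 i (Finset.mem_univ i)
      rw [D.E.prod_pow_blockExp, add_sub_assoc]
      simpa [TrinomialExponents.monomial] using this
  have h0 : G₀ = 0 := (mul_eq_zero.1 hprod).resolve_right hQ0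
  have h1 : coeff e₀ G₀ = coeff e₀ G := by
    rw [hG₀, coeff_sum, Finset.sum_eq_single e₀]
    · simp
    · intro e _ he
      simp [coeff_monomial, he]
    · intro hn
      exact absurd (hS ▸ Finset.mem_filter.2 ⟨he₀, rfl⟩) hn
  rw [h0, coeff_zero] at h1
  exact mem_support_iff.1 he₀ h1.symm

theorem eq_zero_of_evalAt_eq_zero (f : D.R)
    (h : ∀ x (hx : x ∈ D.torusPoints), evalAt hx f = 0) : f = 0 := by
  obtain ⟨F, rfl⟩ := Ideal.Quotient.mk_surjective f
  obtain ⟨G, hG, hFG⟩ := D.exists_reduced F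
  rw [hFG]
  rw [eq_zero_of_eval_eq_zero hG, map_zero]
  intro x hx
  rw [← evalAt_mk hx, ← hFG, h]

/-- If `m = 0` and two of the monomials have all their exponents at least two, the variety is
rigid. -/
theorem isRigid (hm : D.E.m = 0) {i₁ i₂ : Fin D.r} (hi : i₁ ≠ i₂) (h₁ : ∀ j, 2 ≤ D.E.l i₁ j)
    (h₂ : ∀ j, 2 ≤ D.E.l i₂ j) : IsRigid K D.R := by
  intro d hd
  have h0 (v : D.E.Var) : d (D.coord v) = 0 := by
    refine eq_zero_of_evalAt_eq_zero _ fun x hx => ?_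
    rcases v with ⟨i, j⟩ | k
    · refine D.apply_isLND_coord_eq_zero hd _ (fun v => ?_) hi h₁ h₂ i j
      rw [evalAt_mk, eval_X]
      exact hx.1 v
    · exact absurd k.2 (by omega)
  have htop : d.constants = ⊤ := MvPolynomial.subalgebra_quotient_eq_top h0
  ext f
  exact Algebra.eq_top_iff.1 htop f

theorem isOfTypeA (h : ¬ IsRigid K D.R) : IsOfTypeA K D.R := by
  rcases Nat.eq_zero_or_pos D.E.m with hm | hm
  · by_cases hb : ∃ b : Fin D.r, ∀ i, i ≠ b → ∃ j, D.E.l i j = 1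
    · obtain ⟨b, hb⟩ := hb
      exact D.isOfTypeA_of_exists b hb
    · push Not at hb
      have htwo {i : Fin D.r} (hi : ∀ j, D.E.l i j ≠ 1) (j) : 2 ≤ D.E.l i j := by
        have := D.E.l_pos i j
        have := hi j
        omega
      obtain ⟨i₁, _, h₁⟩ := hb D.o
      obtain ⟨i₂, hi, h₂⟩ := hb i₁
      exact absurd (isRigid hm hi (htwo h₂) (htwo h₁)) h
  · exact D.isOfTypeA_of_pos hm

end

end TrinomialDataOne

end VanishingOnPoints

/-! ### Derivations and powers of ideals -/

section IdealPowers

variable {K C : Type*} [CommRing K] [CommRing C] [Algebra K C]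

theorem Derivation.apply_mem_pow_pred (D : Derivation K C C) (I : Ideal C) (n : ℕ) {f : C}
    (hf : f ∈ I ^ n) : D f ∈ I ^ (n - 1) := by
  induction n generalizing f with
  | zero => simp
  | succ n ih =>
    rw [pow_succ] at hf
    induction hf using Submodule.mul_induction_on' with
    | mem_mul_mem a ha b hb =>
      rw [leibniz, smul_eq_mul, smul_eq_mul, Nat.add_sub_cancel]
      refine add_mem (Ideal.mul_mem_right _ _ ha) ?_
      rcases n with _ | n
      · simp
      · rw [pow_succ']
        exact Ideal.mul_mem_mul hb (ih ha)
    | add a _ b _ ha hb =>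
      rw [map_add]
      exact add_mem ha hb

theorem Ideal.prod_pow_mem_pow_sum {ι : Type*} (s : Finset ι) (I : Ideal C) (x : ι → C)
    (l : ι → ℕ) (h : ∀ i ∈ s, x i ∈ I) : ∏ i ∈ s, x i ^ l i ∈ I ^ ∑ i ∈ s, l i := by
  rw [← Finset.prod_pow_eq_pow_sum]
  exact Ideal.prod_mem_prod fun i hi => Ideal.pow_mem_pow (h i hi) _

theorem Ideal.pow_dvd_map_of_mem_comap_pow {C' : Type*} [CommRing C'] (φ : C →+* C') (t : C')
    {n : ℕ} {f : C} (hf : f ∈ (Ideal.span {t}).comap φ ^ n) : t ^ n ∣ φ f := by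
  rw [← Ideal.mem_span_singleton, ← Ideal.span_singleton_pow]
  exact Ideal.pow_right_mono Ideal.map_comap_le n
    (Ideal.map_pow φ _ n ▸ Ideal.mem_map_of_mem φ hf)

end IdealPowers

/-! ### Degrees and weights of the monomials -/

namespace TrinomialExponents

variable {N : ℕ} (E : TrinomialExponents N)

theorem two_le_sum_of_not_isSingleVariable {i : Fin N} (h : ¬ E.IsSingleVariable i) :
    2 ≤ ∑ j, E.l i j := by
  by_contra hlt
  have hn : E.n i ≤ ∑ j, E.l i j := by
    calc E.n i = ∑ _j : Fin (E.n i), 1 := by simp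
      _ ≤ _ := Finset.sum_le_sum fun j _ => E.l_pos i j
  refine h ⟨by have := E.n_pos i; omega, fun j => ?_⟩
  have h1 := Finset.single_le_sum (f := E.l i) (fun _ _ => Nat.zero_le _) (Finset.mem_univ j)
  have h2 := E.l_pos i j
  omega

/-- Positive weights of the variables for which all the monomials have the same degree. -/
theorem exists_weights : ∃ (w : E.Var → ℕ) (W : ℕ), (∀ v, 0 < w v) ∧
    ∀ i, ∑ j, w (Sum.inl ⟨i, j⟩) * E.l i j = W := by
  classical
  -- Multiplying the weight by l_ij completes the product of all exponents; summing over the n_i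
  -- variables of the block then completes the product of the block sizes.
  refine ⟨Sum.elim (fun p => (∏ p' ∈ Finset.univ.erase p, E.l p'.1 p'.2) *
    ∏ i ∈ Finset.univ.erase p.1, E.n i) fun _ => 1,
    (∏ p : Σ i : Fin N, Fin (E.n i), E.l p.1 p.2) * ∏ i, E.n i, ?_, fun i => ?_⟩
  · rintro (p | k)
    · exact Nat.mul_pos (Finset.prod_pos fun p' _ => E.l_pos _ _)
        (Finset.prod_pos fun i _ => E.n_pos i)
    · exact one_pos
  · have h1 (j : Fin (E.n i)) : (∏ p' ∈ Finset.univ.erase (⟨i, j⟩ : Σ i : Fin N, Fin (E.n i)),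
        E.l p'.1 p'.2) * E.l i j = ∏ p : Σ i : Fin N, Fin (E.n i), E.l p.1 p.2 :=
      Finset.prod_erase_mul _ (fun p : Σ i : Fin N, Fin (E.n i) => E.l p.1 p.2)
        (Finset.mem_univ _)
    have h2 : E.n i * (∏ i' ∈ Finset.univ.erase i, E.n i') = ∏ i, E.n i :=
      Finset.mul_prod_erase _ _ (Finset.mem_univ i)
    have h3 (j : Fin (E.n i)) : ((∏ p' ∈ Finset.univ.erase (⟨i, j⟩ : Σ i : Fin N, Fin (E.n i)),
        E.l p'.1 p'.2) * ∏ i' ∈ Finset.univ.erase i, E.n i') * E.l i j =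
        (∏ p : Σ i : Fin N, Fin (E.n i), E.l p.1 p.2) * ∏ i' ∈ Finset.univ.erase i, E.n i' := by
      rw [mul_right_comm, h1]
    refine (Finset.sum_congr rfl fun j _ => h3 j).trans ?_
    rw [Finset.sum_const, Finset.card_univ, Fintype.card_fin, smul_eq_mul, ← h2]
    ring

end TrinomialExponents

/-! ### Linear relations among the monomials in Type 2 -/

namespace TrinomialDataTwo

variable {K : Type*} [Field K] (D : TrinomialDataTwo K)

/-- The class of a variable in `R(A)`. -/
noncomputable abbrev coord (v : D.E.Var) : D.R := Ideal.Quotient.mk D.ideal (MvPolynomial.X v)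

/-- The class of `Tᵢ^{lᵢ}` in `R(A)`. -/
noncomputable abbrev mon (i : Fin (D.r + 1)) : D.R := Ideal.Quotient.mk D.ideal (D.E.monomial K i)

theorem mon_eq (i : Fin (D.r + 1)) : D.mon i = ∏ j, D.coord (Sum.inl ⟨i, j⟩) ^ D.E.l i j := by
  simp [mon, TrinomialExponents.monomial]

/-- The minor of the columns `i` and `j`. -/
def minor (i j : Fin (D.r + 1)) : K := D.A 0 i * D.A 1 j - D.A 0 j * D.A 1 i

theorem minor_ne_zero {i j : Fin (D.r + 1)} (hij : i ≠ j) : D.minor i j ≠ 0 := by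
  intro h
  have hli := LinearIndependent.pair_iff.1 (D.A_pairwise i j hij)
  have key (s t : K) (h0 : s * D.A 0 i + t * D.A 0 j = 0) (h1 : s * D.A 1 i + t * D.A 1 j = 0) :
      s = 0 ∧ t = 0 := by
    refine hli s t ?_
    ext k
    fin_cases k
    · simpa using h0
    · simpa using h1
  unfold minor at h
  obtain ⟨h1, h2⟩ := key (D.A 1 j) (-D.A 1 i) (by linear_combination h) (by ring)
  obtain ⟨h3, h4⟩ := key (D.A 0 j) (-D.A 0 i) (by ring) (by linear_combination -h)
  rw [neg_eq_zero] at h2 h4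
  exact one_ne_zero (key 1 0 (by simp [h4]) (by simp [h2])).1

theorem g_eq (i : ℕ) (hi : i + 2 < D.r + 1) :
    D.g i hi = D.minor ⟨i + 1, by omega⟩ ⟨i + 2, hi⟩ • D.E.monomial K ⟨i, by omega⟩
      - D.minor ⟨i, by omega⟩ ⟨i + 2, hi⟩ • D.E.monomial K ⟨i + 1, by omega⟩
      + D.minor ⟨i, by omega⟩ ⟨i + 1, by omega⟩ • D.E.monomial K ⟨i + 2, hi⟩ := by
  simp only [g, Matrix.det_fin_three, Matrix.of_apply, Matrix.cons_val_zero, Matrix.cons_val_one,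
    Matrix.cons_val, minor, MvPolynomial.smul_eq_C_mul, map_sub, map_mul]
  ring

/-- A vector that satisfies the relations among the monomials is a combination of the rows. -/
theorem exists_eq_smul_add_smul {M : Type*} [AddCommGroup M] [Module K M] (v : Fin (D.r + 1) → M)
    (hv : ∀ i (hi : i + 2 < D.r + 1), D.minor ⟨i + 1, by omega⟩ ⟨i + 2, hi⟩ • v ⟨i, by omega⟩
      - D.minor ⟨i, by omega⟩ ⟨i + 2, hi⟩ • v ⟨i + 1, by omega⟩
      + D.minor ⟨i, by omega⟩ ⟨i + 1, by omega⟩ • v ⟨i + 2, hi⟩ = 0) :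
    ∃ p q : M, ∀ i, v i = D.A 0 i • p + D.A 1 i • q := by
  have hr := D.r_pos
  set i₀ : Fin (D.r + 1) := ⟨0, by omega⟩ with hi₀
  set i₁ : Fin (D.r + 1) := ⟨1, by omega⟩ with hi₁
  have hne : D.minor i₀ i₁ ≠ 0 := D.minor_ne_zero (by simp [hi₀, hi₁])
  -- Cramer's rule for the first two columns; each relation then determines the next entry from the
  -- two before it, as consecutive minors are nonzero.
  set p := (D.minor i₀ i₁)⁻¹ • (D.A 1 i₁ • v i₀ - D.A 1 i₀ • v i₁) with hp
  set q := (D.minor i₀ i₁)⁻¹ • (D.A 0 i₀ • v i₁ - D.A 0 i₁ • v i₀) with hq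
  have hp' : D.minor i₀ i₁ • p = D.A 1 i₁ • v i₀ - D.A 1 i₀ • v i₁ := by
    rw [hp, smul_inv_smul₀ hne]
  have hq' : D.minor i₀ i₁ • q = D.A 0 i₀ • v i₁ - D.A 0 i₁ • v i₀ := by
    rw [hq, smul_inv_smul₀ hne]
  have key (n : ℕ) : (∀ h : n < D.r + 1, v ⟨n, h⟩ = D.A 0 ⟨n, h⟩ • p + D.A 1 ⟨n, h⟩ • q) ∧
      ∀ h : n + 1 < D.r + 1, v ⟨n + 1, h⟩ = D.A 0 ⟨n + 1, h⟩ • p + D.A 1 ⟨n + 1, h⟩ • q := by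
    induction n with
    | zero =>
      refine ⟨fun h => ?_, fun h => ?_⟩
      · apply smul_right_injective _ hne
        simp only [smul_add, smul_comm (D.minor i₀ i₁), hp', hq']
        change D.minor i₀ i₁ • v i₀ = D.A 0 i₀ • _ + D.A 1 i₀ • _
        rw [minor]
        module
      · apply smul_right_injective _ hne
        simp only [smul_add, smul_comm (D.minor i₀ i₁), hp', hq']
        change D.minor i₀ i₁ • v i₁ = D.A 0 i₁ • _ + D.A 1 i₁ • _
        rw [minor]
        module
    | succ n ih =>
      refine ⟨ih.2, fun h => ?_⟩
      have hg := hv n h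
      rw [ih.1 (by omega), ih.2 (by omega)] at hg
      apply smul_right_injective _ (D.minor_ne_zero (i := ⟨n, by omega⟩)
        (j := ⟨n + 1, by omega⟩) (by simp))
      refine (eq_neg_of_add_eq_zero_right hg).trans ?_
      simp only [minor]
      module
  exact ⟨p, q, fun i => (key i.1).1 i.2⟩

theorem minor_smul_eq {M : Type*} [AddCommGroup M] [Module K M] {v : Fin (D.r + 1) → M}
    {p q : M} (h : ∀ i, v i = D.A 0 i • p + D.A 1 i • q) (i a b : Fin (D.r + 1)) :
    D.minor a b • v i = D.minor i b • v a + D.minor a i • v b := by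
  rw [h i, h a, h b, minor, minor, minor]
  module

theorem minor_smul_mon (i a b : Fin (D.r + 1)) :
    D.minor a b • D.mon i = D.minor i b • D.mon a + D.minor a i • D.mon b := by
  obtain ⟨p, q, h⟩ := D.exists_eq_smul_add_smul D.mon fun i hi => by
    have hg : Ideal.Quotient.mkₐ K D.ideal (D.g i hi) = 0 :=
      Ideal.Quotient.eq_zero_iff_mem.2 (Ideal.subset_span ⟨i, hi, rfl⟩)
    rw [g_eq, map_add, map_sub, map_smul, map_smul, map_smul] at hg
    exact hg
  exact D.minor_smul_eq h i a b

variable {D} in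
/-- The homomorphism that maps the variables to the coordinates of a point. -/
noncomputable def lift {A : Type*} [CommRing A] [Algebra K A] (x : D.E.Var → A)
    (hx : ∀ i (hi : i + 2 < D.r + 1), MvPolynomial.aeval x (D.g i hi) = 0) : D.R →ₐ[K] A :=
  Ideal.Quotient.liftₐ D.ideal (MvPolynomial.aeval x) (by
    intro f hf
    rw [ideal, Ideal.mem_span] at hf
    refine RingHom.mem_ker.1 (hf (RingHom.ker (MvPolynomial.aeval x)) ?_)
    rintro _ ⟨i, hi, rfl⟩
    exact hx i hi)

theorem lift_coord {A : Type*} [CommRing A] [Algebra K A] (x : D.E.Var → A)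
    (hx : ∀ i (hi : i + 2 < D.r + 1), MvPolynomial.aeval x (D.g i hi) = 0) (v : D.E.Var) :
    lift x hx (D.coord v) = x v := by
  change MvPolynomial.aeval x (MvPolynomial.X v) = x v
  simp

theorem aeval_g_eq_zero {A : Type*} [CommRing A] [Algebra K A] (x : D.E.Var → A)
    (hx : ∀ i, ∏ j, x (Sum.inl ⟨i, j⟩) ^ D.E.l i j = 0) (i : ℕ) (hi : i + 2 < D.r + 1) :
    MvPolynomial.aeval x (D.g i hi) = 0 := by
  have hm (k) : MvPolynomial.aeval x (D.E.monomial K k) = 0 := by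
    simp [TrinomialExponents.monomial, hx]
  simp [g_eq, hm]

end TrinomialDataTwo

/-! ### Derivations of a cylinder along a line, and a criterion for type B -/

section PolynomialDerivations

open Polynomial

variable {K B A : Type*} [Field K] [CommRing B] [Algebra K B] [CommRing A] [Algebra K A]
  (δ : Derivation K B[X] B[X])

/-- The product lies in a power, at least the square, of the kernel of the induced map on
polynomials, and a derivation lowers such a power by at most one. -/
theorem map_derivation_prod_eq_zero (γ : B →ₐ[K] A) {ι : Type*} (s : Finset ι) (x : ι → B)
    (l : ι → ℕ) (hl : 2 ≤ ∑ i ∈ s, l i) (hx : ∀ i ∈ s, γ (x i) = 0) :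
    mapAlgHom γ (δ (C (∏ i ∈ s, x i ^ l i))) = 0 := by
  have h1 : C (∏ i ∈ s, x i ^ l i) ∈ RingHom.ker (mapAlgHom γ) ^ ∑ i ∈ s, l i := by
    rw [map_prod]
    simp only [map_pow]
    refine Ideal.prod_pow_mem_pow_sum _ _ _ _ fun i hi => ?_
    rw [RingHom.mem_ker, coe_mapAlgHom, map_C, RingHom.coe_coe, hx i hi, C_0]
  exact Ideal.pow_le_self (I := RingHom.ker (mapAlgHom γ)) (n := ∑ i ∈ s, l i - 1) (by omega)
    (δ.apply_mem_pow_pred _ _ h1)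

theorem map_derivation_eq_zero_of_smul_eq (γ : B →ₐ[K] A) {f g h : B} {a b c : K} (ha : a ≠ 0)
    (e : a • f = b • g + c • h) (hg : mapAlgHom γ (δ (C g)) = 0)
    (hh : mapAlgHom γ (δ (C h)) = 0) : mapAlgHom γ (δ (C f)) = 0 := by
  have h1 := congr_arg (fun f => mapAlgHom γ (δ (C f))) e
  simp only [← smul_C, map_add, Derivation.map_smul, map_smul, hg, hh, smul_zero,
    add_zero] at h1
  exact (smul_eq_zero_iff_right ha).1 h1

/-- Let z be the product of the `x i ^ k i`. Then γ(δ z) is divisible by t^(∑k - 1), so t^(2l) γ(δ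
z) = 0, and the Leibniz rule leaves l t^(2(l-1)+∑k) γ(δ y) = 0. Giving `y` order two makes its term
the one of lower order: the exponent is one below that at which t is assumed to vanish. -/
theorem map_derivation_eq_zero_of_curve (γ : B →ₐ[K] A) (ω : A →ₐ[K] K) {y : B} {ι : Type*}
    (s : Finset ι) (x : ι → B) (k : ι → ℕ) {l : ℕ} {t : A} (hy : γ y = t ^ 2)
    (hx : ∀ i ∈ s, γ (x i) = t) (ht : ∀ n, 2 * l + ∑ i ∈ s, k i - 1 ≤ n → t ^ n = 0)
    (hω : ∀ f, (l : K) • (t ^ (2 * (l - 1) + ∑ i ∈ s, k i) * f) = 0 → ω f = 0)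
    (hδ : mapAlgHom γ (δ (C (y ^ l * ∏ i ∈ s, x i ^ k i))) = 0) :
    mapAlgHom (ω.comp γ) (δ (C y)) = 0 := by
  set Γ := mapAlgHom γ with hΓ
  set z : B[X] := ∏ i ∈ s, C (x i) ^ k i with hz
  have hΓC (b : B) : Γ (C b) = C (γ b) := by rw [hΓ, coe_mapAlgHom, map_C, RingHom.coe_coe]
  have hyz : C (y ^ l * ∏ i ∈ s, x i ^ k i) = C y ^ l * z := by
    rw [C_mul, C_pow, map_prod]
    simp only [map_pow, hz]
  have hΓz : Γ z = C t ^ ∑ i ∈ s, k i := by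
    rw [hz, map_prod, ← Finset.prod_pow_eq_pow_sum]
    refine Finset.prod_congr rfl fun i hi => ?_
    rw [map_pow, hΓC, hx i hi]
  have hδz : C t ^ (∑ i ∈ s, k i - 1) ∣ Γ (δ z) := by
    refine Ideal.pow_dvd_map_of_mem_comap_pow (Γ : B[X] →+* A[X]) (C t)
      (δ.apply_mem_pow_pred _ _ (Ideal.prod_pow_mem_pow_sum _ _ _ _ fun i hi => ?_))
    rw [Ideal.mem_comap, RingHom.coe_coe, hΓC, hx i hi]
    exact Ideal.mem_span_singleton_self _
  rw [hyz, Derivation.leibniz, Derivation.leibniz_pow] at hδ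
  simp only [smul_eq_mul, nsmul_eq_mul, map_add, map_mul, map_pow, map_natCast, hΓC, hy,
    hΓz] at hδ
  have h1 : (C t ^ 2) ^ l * Γ (δ z) = 0 := by
    obtain ⟨u, hu⟩ := hδz
    rw [hu, ← pow_mul, ← mul_assoc, ← pow_add, ← C_pow, ht _ (by omega), C_0, zero_mul]
  rw [h1, zero_add] at hδ
  ext n
  rw [coe_mapAlgHom, coeff_map, coeff_zero, RingHom.coe_coe, AlgHom.comp_apply]
  apply hω
  have h3 : C t ^ (∑ i ∈ s, k i) * ((l : A[X]) * ((C t ^ 2) ^ (l - 1) * Γ (δ (C y)))) =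
      C ((l : A) * t ^ (2 * (l - 1) + ∑ i ∈ s, k i)) * Γ (δ (C y)) := by
    rw [C_mul, C_pow, pow_add, ← pow_mul, C_eq_natCast]
    ring
  have h2 := congr_arg (fun f => coeff f n) hδ
  simp only [h3, coeff_C_mul, coeff_zero] at h2
  rw [hΓ, coe_mapAlgHom, coeff_map, RingHom.coe_coe] at h2
  rw [Algebra.smul_def, ← mul_assoc, map_natCast]
  exact h2

/-- If the images of the generators under `δ` vanish where `ε` does, then `δ` restricts to the line
`ε = 0`. -/
theorem map_derivation_apply {ε : B →ₐ[K] K} {X' : Set B} (hX' : Algebra.adjoin K X' = ⊤)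
    (h : ∀ x ∈ X', mapAlgHom ε (δ (C x)) = 0) (f : B[X]) :
    mapAlgHom ε (δ f) = derivative (mapAlgHom ε f) * mapAlgHom ε (δ X) := by
  have hC (b : B) : mapAlgHom ε (δ (C b)) = 0 := by
    have hb : b ∈ Algebra.adjoin K X' := hX' ▸ Algebra.mem_top
    induction hb using Algebra.adjoin_induction with
    | mem x hx => exact h x hx
    | algebraMap r =>
      have : (C (algebraMap K B r) : B[X]) = algebraMap K B[X] r := rfl
      rw [this, Derivation.map_algebraMap, map_zero]
    | add x y _ _ hx hy => rw [C_add, map_add, map_add, hx, hy, add_zero]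
    | mul x y _ _ hx hy =>
      rw [C_mul, Derivation.leibniz, smul_eq_mul, smul_eq_mul, map_add, map_mul, map_mul, hx, hy,
        mul_zero, mul_zero, add_zero]
  induction f using Polynomial.induction_on' with
  | add p q hp hq => rw [map_add, map_add, map_add, derivative_add, hp, hq, add_mul]
  | monomial n a =>
    rw [← C_mul_X_pow_eq_monomial, Derivation.leibniz, Derivation.leibniz_pow]
    simp only [smul_eq_mul, nsmul_eq_mul, map_add, map_mul, map_pow, map_natCast, hC, mul_zero,
      add_zero]
    rw [coe_mapAlgHom, map_C, map_X, derivative_mul, derivative_C, derivative_X_pow]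
    simp only [zero_mul, zero_add, C_eq_natCast]
    ring

theorem prod_C_mul_X_pow_pow {ι : Type*} (s : Finset ι) (x : ι → B) (w l : ι → ℕ) :
    ∏ i ∈ s, (C (x i) * X ^ w i) ^ l i = C (∏ i ∈ s, x i ^ l i) * X ^ ∑ i ∈ s, w i * l i := by
  simp only [mul_pow, Finset.prod_mul_distrib, ← pow_mul, Finset.prod_pow_eq_pow_sum, map_prod,
    map_pow]

variable [CharZero K]

/-- On the line ε = 0 a derivation becomes h d/dX with h the image of δ X. A slice gives s' h = 1,
so h ≠ 0, and δ f = 0 forces f to be constant there. -/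
theorem HDStar_le_comap {ε : B →ₐ[K] K} {X' : Set B} (hX' : Algebra.adjoin K X' = ⊤)
    (h : ∀ δ : Derivation K B[X] B[X], ∀ x ∈ X', mapAlgHom ε (δ (C x)) = 0) :
    HDStar K B[X] ≤ (⊥ : Subalgebra K K[X]).comap (mapAlgHom ε) := by
  rw [HDStar, Algebra.adjoin_le_iff]
  rintro f ⟨δ, -, ⟨s, hs⟩, hf⟩
  have h1 := map_derivation_apply δ hX' (h δ) s
  have h2 := map_derivation_apply δ hX' (h δ) f
  rw [hs, map_one] at h1
  rw [hf, map_zero] at h2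
  have h3 : mapAlgHom ε (δ X) ≠ 0 := right_ne_zero_of_mul (h1 ▸ one_ne_zero)
  have h4 := derivative_eq_zero.1 ((mul_eq_zero.1 h2.symm).resolve_right h3)
  rw [SetLike.mem_coe, Subalgebra.mem_comap, Algebra.mem_bot]
  exact ⟨_, (eq_C_of_natDegree_eq_zero h4).symm⟩

/-- For a grading `Φ` of `B` with `B₀ = K` and `M ∈ ℕ`, the elements of `B[X]` whose component of
degree `n` has degree at most `n * M` in `X`. -/
def slopeSubalgebra (Φ : B →ₐ[K] B[X]) (M : ℕ) : Subalgebra K B[X] where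
  carrier := {f | ∀ n i, n * M < i → (Φ (f.coeff i)).coeff n = 0}
  add_mem' hf hg n i h := by
    rw [coeff_add, map_add, coeff_add, hf n i h, hg n i h, add_zero]
  mul_mem' {f g} hf hg n i h := by
    rw [coeff_mul, map_sum, finsetSum_coeff]
    refine Finset.sum_eq_zero fun p hp => ?_
    rw [map_mul, coeff_mul]
    refine Finset.sum_eq_zero fun q hq => ?_
    rw [Finset.HasAntidiagonal.mem_antidiagonal] at hp hq
    by_cases h1 : q.1 * M < p.1
    · rw [hf _ _ h1, zero_mul]
    · rw [hg q.2 p.2, mul_zero]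
      have : n * M = q.1 * M + q.2 * M := by rw [← hq, add_mul]
      omega
  algebraMap_mem' r n i h := by
    rw [Polynomial.algebraMap_apply, coeff_C, if_neg (by omega), map_zero, coeff_zero]

/-- Finitely many generators have X-degree at most some `M`, and their weight-zero components are
constant in X, so HD* lies in `slopeSubalgebra Φ M`. The elements X^k d(b) exceed this slope for
large k. -/
theorem isOfTypeB_of_grading {ε : B →ₐ[K] K} {X' : Set B} (hX' : Algebra.adjoin K X' = ⊤)
    (h : ∀ δ : Derivation K B[X] B[X], ∀ x ∈ X', mapAlgHom ε (δ (C x)) = 0)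
    (Φ : B →ₐ[K] B[X]) (hΦ : ∀ b, (Φ b).eval 1 = b)
    (hΦ₀ : ∀ b, (Φ b).coeff 0 = algebraMap K B (ε b)) (hB : ¬ IsRigid K B) : IsOfTypeB K B := by
  rintro ⟨S, hS⟩
  obtain ⟨M, hM⟩ : ∃ M : ℕ, ∀ f ∈ S, f.natDegree ≤ M :=
    ⟨S.sup natDegree, fun f hf => Finset.le_sup hf⟩
  have hle : HDStar K B[X] ≤ slopeSubalgebra Φ M := by
    rw [← hS, Algebra.adjoin_le_iff]
    intro f hf n i hi
    rcases n with _ | n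
    · have h1 : f ∈ HDStar K B[X] := hS ▸ Algebra.subset_adjoin hf
      have h2 := HDStar_le_comap hX' h h1
      rw [Subalgebra.mem_comap, Algebra.mem_bot] at h2
      obtain ⟨c, hc⟩ := h2
      have h3 := congr_arg (fun p => coeff p i) hc
      simp only [coe_mapAlgHom, coeff_map, RingHom.coe_coe, Polynomial.algebraMap_apply] at h3
      rw [coeff_C, if_neg (by omega)] at h3
      rw [hΦ₀, ← h3, map_zero]
    · have h0 : f.coeff i = 0 := by
        apply coeff_eq_zero_of_natDegree_lt
        have := hM f hf
        rw [Nat.succ_mul] at hi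
        omega
      rw [h0, map_zero, coeff_zero]
  rw [IsRigid] at hB
  push Not at hB
  obtain ⟨d, hd, hd0⟩ := hB
  obtain ⟨b, hb⟩ : ∃ b, d b ≠ 0 := by
    by_contra hall
    push Not at hall
    exact hd0 (Derivation.ext hall)
  obtain ⟨n, hn⟩ : ∃ n, (Φ (d b)).coeff n ≠ 0 := by
    by_contra hall
    push Not at hall
    have : Φ (d b) = 0 := Polynomial.ext hall
    apply hb
    rw [← hΦ (d b), this, eval_zero]
  have h1 := hle (Derivation.X_pow_mul_C_mem_HDStar (n * M + 1) hd (Nat.le_add_left _ _) b)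
  apply hn
  simpa using h1 n (n * M + 1) (Nat.lt_succ_self _)

end PolynomialDerivations

/-! ### Type B: the test curve, the grading and the conclusion -/

namespace TrinomialDataTwo

open Polynomial

variable {K : Type*} [Field K] (D : TrinomialDataTwo K)

theorem prod_zero_pow_eq_zero {A : Type*} [CommRing A] (i : Fin (D.r + 1)) :
    ∏ j, (0 : A) ^ D.E.l i j = 0 :=
  Finset.prod_eq_zero (Finset.mem_univ ⟨0, D.E.n_pos i⟩) (zero_pow (D.E.l_pos _ _).ne')

/-- Evaluation at the origin. -/
noncomputable def origin : D.R →ₐ[K] K :=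
  lift (D := D) (fun _ => 0) (D.aeval_g_eq_zero _ D.prod_zero_pow_eq_zero)

theorem origin_coord (v : D.E.Var) : D.origin (D.coord v) = 0 := D.lift_coord _ _ v

section Curve

variable (i : Fin (D.r + 1)) (j : Fin (D.E.n i))

/-- The sum of the exponents of the variables of the `i`-th block other than `Tᵢⱼ`. -/
def coDegree : ℕ := ∑ j' ∈ Finset.univ.erase j, D.E.l i j'

theorem curve_prod {A : Type*} [CommRing A] (t : A) :
    ∏ j', (if (⟨i, j'⟩ : Σ i, Fin (D.E.n i)) = ⟨i, j⟩ then t ^ 2 else t) ^ D.E.l i j' =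
      t ^ (2 * D.E.l i j + D.coDegree i j) := by
  rw [← Finset.mul_prod_erase _ _ (Finset.mem_univ j), if_pos rfl, pow_add, ← pow_mul, coDegree,
    ← Finset.prod_pow_eq_pow_sum]
  congr 1
  refine Finset.prod_congr rfl fun j' hj' => ?_
  rw [if_neg]
  simpa using Finset.ne_of_mem_erase hj'

/-- The truncated polynomial ring `K[τ]/(τ^(L-1))`, where `L` is the degree of `Tᵢ^{lᵢ}` if `Tᵢⱼ`
has degree two and the other variables have degree one. -/
abbrev CurveRing : Type _ :=
  K[X] ⧸ Ideal.span {(X : K[X]) ^ (2 * D.E.l i j + D.coDegree i j - 1)}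

/-- The class of `τ`. -/
noncomputable abbrev tau : D.CurveRing i j := Ideal.Quotient.mk _ X

theorem tau_pow_eq_zero {n : ℕ} (hn : 2 * D.E.l i j + D.coDegree i j - 1 ≤ n) :
    D.tau i j ^ n = 0 := by
  rw [tau, ← map_pow, Ideal.Quotient.eq_zero_iff_mem, Ideal.mem_span_singleton]
  exact pow_dvd_pow _ hn

open Classical in
/-- The coordinates of the curve `Tᵢⱼ = τ²`, `Tᵢⱼ' = τ`, on which the variables outside the `i`-th
block vanish. -/
noncomputable def curvePoint : D.E.Var → D.CurveRing i j :=
  Sum.elim (fun p => if p.1 = i then if p = ⟨i, j⟩ then D.tau i j ^ 2 else D.tau i j else 0)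
    fun _ => 0

/-- The homomorphism of restriction to the curve. -/
noncomputable def curve : D.R →ₐ[K] D.CurveRing i j :=
  lift (D := D) (D.curvePoint i j) (D.aeval_g_eq_zero _ fun i' => by
    classical
    by_cases hi : i' = i
    · subst hi
      simp only [curvePoint, Sum.elim_inl, if_true]
      -- T_i^{l_i} maps to τ^L, which is zero in the truncated ring; only thanks to the truncation
      -- do the relations hold.
      rw [D.curve_prod, D.tau_pow_eq_zero _ _ (Nat.sub_le _ _)]
    · simp only [curvePoint, Sum.elim_inl, if_neg hi]
      exact D.prod_zero_pow_eq_zero i')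

theorem curve_coord (v : D.E.Var) : D.curve i j (D.coord v) = D.curvePoint i j v :=
  D.lift_coord _ _ v

theorem curve_coord_self : D.curve i j (D.coord (Sum.inl ⟨i, j⟩)) = D.tau i j ^ 2 := by
  rw [curve_coord]
  simp [curvePoint]

theorem curve_coord_of_ne {j' : Fin (D.E.n i)} (h : j' ≠ j) :
    D.curve i j (D.coord (Sum.inl ⟨i, j'⟩)) = D.tau i j := by
  rw [curve_coord]
  simp [curvePoint, h]

theorem curve_coord_eq_zero {i' : Fin (D.r + 1)} (h : i' ≠ i) (j') :
    D.curve i j (D.coord (Sum.inl ⟨i', j'⟩)) = 0 := by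
  rw [curve_coord]
  simp [curvePoint, h]

theorem length_pos : 1 < 2 * D.E.l i j + D.coDegree i j := by
  have := D.E.l_pos i j
  omega

/-- Evaluation at `τ = 0`. -/
noncomputable def curveOrigin : D.CurveRing i j →ₐ[K] K :=
  Ideal.Quotient.liftₐ _ (aeval (0 : K)) (by
    intro f hf
    rw [Ideal.mem_span_singleton] at hf
    obtain ⟨g, rfl⟩ := hf
    have := D.length_pos i j
    rw [map_mul, map_pow, aeval_X, zero_pow (by omega), zero_mul])

theorem curveOrigin_mk (p : K[X]) :
    D.curveOrigin i j (Ideal.Quotient.mk _ p) = p.coeff 0 := by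
  change aeval (0 : K) p = _
  rw [coeff_zero_eq_eval_zero, coe_aeval_eq_eval]

theorem curveOrigin_curve (f : D.R) : D.curveOrigin i j (D.curve i j f) = D.origin f := by
  suffices h : (D.curveOrigin i j).comp (D.curve i j) = D.origin from DFunLike.congr_fun h f
  refine Ideal.Quotient.algHom_ext _ (MvPolynomial.algHom_ext fun v => ?_)
  change D.curveOrigin i j (D.curve i j (D.coord v)) = D.origin (D.coord v)
  rw [origin_coord, curve_coord, curvePoint]
  have h0 : D.curveOrigin i j (D.tau i j) = 0 := by rw [tau, curveOrigin_mk, coeff_X_zero]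
  rcases v with p | k
  · simp only [Sum.elim_inl]
    split_ifs <;> simp [h0]
  · simp

variable [CharZero K]

theorem curveOrigin_eq_zero {f : D.CurveRing i j}
    (h : (D.E.l i j : K) • (D.tau i j ^ (2 * (D.E.l i j - 1) + D.coDegree i j) * f) = 0) :
    D.curveOrigin i j f = 0 := by
  obtain ⟨p, rfl⟩ := Ideal.Quotient.mk_surjective f
  have hl : (D.E.l i j : K) ≠ 0 := by exact_mod_cast (D.E.l_pos i j).ne'
  have h1 := (smul_eq_zero_iff_right hl).1 h
  rw [tau, ← map_pow, ← map_mul, Ideal.Quotient.eq_zero_iff_mem, Ideal.mem_span_singleton] at h1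
  have h2 : 2 * D.E.l i j + D.coDegree i j - 1 = 2 * (D.E.l i j - 1) + D.coDegree i j + 1 := by
    have := D.E.l_pos i j
    omega
  rw [h2, pow_succ] at h1
  have h3 := (mul_dvd_mul_iff_left (pow_ne_zero _ X_ne_zero)).1 h1
  rw [curveOrigin_mk]
  exact X_dvd_iff.1 h3

end Curve

theorem exists_ne_of_three_le_ncard (h : 3 ≤ {i | ¬ D.E.IsSingleVariable i}.ncard)
    (i : Fin (D.r + 1)) : ∃ a b, a ≠ b ∧ a ≠ i ∧ b ≠ i ∧ ¬ D.E.IsSingleVariable a ∧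
      ¬ D.E.IsSingleVariable b := by
  have h1 := Set.pred_ncard_le_ncard_sdiff_singleton {i | ¬ D.E.IsSingleVariable i} i
  obtain ⟨a, b, ha, hb, hab⟩ := (Set.one_lt_ncard_iff (Set.toFinite _)).1
    (show 1 < ({i | ¬ D.E.IsSingleVariable i} \ {i}).ncard by omega)
  exact ⟨a, b, hab, ha.2, hb.2, ha.1, hb.1⟩

theorem adjoin_range_coord : Algebra.adjoin K (Set.range D.coord) = ⊤ :=
  MvPolynomial.subalgebra_quotient_eq_top fun v => Algebra.subset_adjoin ⟨v, rfl⟩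

/-- If at least three of the monomials are not single variables, every derivation of the coordinate
ring of the cylinder preserves the line over the origin. -/
theorem map_origin_derivation_coord [CharZero K]
    (h : 3 ≤ {i | ¬ D.E.IsSingleVariable i}.ncard) (δ : Derivation K D.R[X] D.R[X])
    (i : Fin (D.r + 1)) (j : Fin (D.E.n i)) :
    mapAlgHom D.origin (δ (C (D.coord (Sum.inl ⟨i, j⟩)))) = 0 := by
  obtain ⟨a, b, hab, ha, hb, ha', hb'⟩ := D.exists_ne_of_three_le_ncard h i
  have hω : (D.curveOrigin i j).comp (D.curve i j) = D.origin :=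
    AlgHom.ext (D.curveOrigin_curve i j)
  have key (c : Fin (D.r + 1)) (hc : c ≠ i) (hc' : ¬ D.E.IsSingleVariable c) :
      mapAlgHom (D.curve i j) (δ (C (D.mon c))) = 0 := by
    rw [mon_eq]
    exact map_derivation_prod_eq_zero δ _ _ _ _ (D.E.two_le_sum_of_not_isSingleVariable hc')
      fun j' _ => D.curve_coord_eq_zero i j hc j'
  have hi : mapAlgHom (D.curve i j) (δ (C (D.mon i))) = 0 :=
    map_derivation_eq_zero_of_smul_eq δ _ (D.minor_ne_zero hab) (D.minor_smul_mon i a b)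
      (key a ha ha') (key b hb hb')
  rw [← hω]
  refine map_derivation_eq_zero_of_curve δ (D.curve i j) (D.curveOrigin i j)
    (Finset.univ.erase j) (fun j' => D.coord (Sum.inl ⟨i, j'⟩)) (D.E.l i) (l := D.E.l i j)
    (D.curve_coord_self i j) (fun j' hj' => D.curve_coord_of_ne i j (Finset.ne_of_mem_erase hj'))
    (fun n hn => D.tau_pow_eq_zero i j hn) (fun f hf => D.curveOrigin_eq_zero i j hf) ?_
  rwa [Finset.mul_prod_erase _ (fun j' => D.coord (Sum.inl ⟨i, j'⟩) ^ D.E.l i j')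
    (Finset.mem_univ j), ← mon_eq]

/-- The positive weights make the relations homogeneous; as no variable has weight zero, the
degree-zero part is evaluation at the origin. -/
theorem exists_grading : ∃ Φ : D.R →ₐ[K] D.R[X], (∀ b, (Φ b).eval 1 = b) ∧
    ∀ b, (Φ b).coeff 0 = algebraMap K D.R (D.origin b) := by
  obtain ⟨w, W, hw, hW⟩ := D.E.exists_weights
  have hmon (i) : ∏ j, (C (D.coord (Sum.inl ⟨i, j⟩)) * X ^ w (Sum.inl ⟨i, j⟩)) ^ D.E.l i j =
      C (D.mon i) * X ^ W := by
    rw [prod_C_mul_X_pow_pow, hW, ← mon_eq]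
  let Φ : D.R →ₐ[K] D.R[X] := lift (fun v => C (D.coord v) * X ^ w v) (by
    intro i hi
    have hm (k) : MvPolynomial.aeval (fun v => C (D.coord v) * X ^ w v) (D.E.monomial K k) =
        C (D.mon k) * X ^ W := by
      rw [← hmon, TrinomialExponents.monomial, map_prod]
      simp
    have hg : Ideal.Quotient.mkₐ K D.ideal (D.g i hi) = 0 :=
      Ideal.Quotient.eq_zero_iff_mem.2 (Ideal.subset_span ⟨i, hi, rfl⟩)
    rw [g_eq, map_add, map_sub, map_smul, map_smul, map_smul] at hg ⊢
    rw [hm, hm, hm, ← smul_mul_assoc, ← smul_mul_assoc, ← smul_mul_assoc, smul_C, smul_C, smul_C,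
      ← sub_mul, ← add_mul, ← C_sub, ← C_add]
    refine (congr_arg (fun f => C f * X ^ W) hg).trans ?_
    simp)
  have hΦ (v) : Φ (D.coord v) = C (D.coord v) * X ^ w v := D.lift_coord _ _ v
  refine ⟨Φ, fun b => ?_, fun b => ?_⟩
  · have hb : b ∈ Algebra.adjoin K (Set.range D.coord) := D.adjoin_range_coord ▸ Algebra.mem_top
    induction hb using Algebra.adjoin_induction with
    | mem x hx =>
      obtain ⟨v, rfl⟩ := hx
      simp [hΦ]
    | algebraMap r => simp [Polynomial.algebraMap_apply]
    | add x y _ _ hx hy => rw [map_add, eval_add, hx, hy]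
    | mul x y _ _ hx hy => rw [map_mul, eval_mul, hx, hy]
  · have hb : b ∈ Algebra.adjoin K (Set.range D.coord) := D.adjoin_range_coord ▸ Algebra.mem_top
    induction hb using Algebra.adjoin_induction with
    | mem x hx =>
      obtain ⟨v, rfl⟩ := hx
      rw [hΦ, origin_coord, map_zero, coeff_C_mul, coeff_X_pow, if_neg (hw v).ne, mul_zero]
    | algebraMap r => simp [Polynomial.algebraMap_apply]
    | add x y _ _ hx hy => rw [map_add, coeff_add, hx, hy, map_add, map_add]
    | mul x y _ _ hx hy => rw [map_mul, mul_coeff_zero, hx, hy, map_mul, map_mul]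

theorem isOfTypeB [CharZero K] (hm : D.E.m = 0)
    (h : 3 ≤ {i | ¬ D.E.IsSingleVariable i}.ncard) (hR : ¬ IsRigid K D.R) : IsOfTypeB K D.R := by
  obtain ⟨Φ, h1, h0⟩ := D.exists_grading
  refine isOfTypeB_of_grading D.adjoin_range_coord (fun δ x hx => ?_) Φ h1 h0 hR
  obtain ⟨v, rfl⟩ := hx
  rcases v with ⟨i, j⟩ | k
  · exact D.map_origin_derivation_coord h δ i j
  · exact absurd k.2 (by omega)

end TrinomialDataTwo

theorem mainTheorem10 {K : Type*} [Field K] [IsAlgClosed K] [CharZero K]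
    {B : Type*} [CommRing B] [Algebra K B] (hB : ¬ IsRigid K B) :
    (∀ D : TrinomialDataOne K, Nonempty (B ≃ₐ[K] D.R) → IsOfTypeA K B) ∧
    (∀ D : TrinomialDataTwo K, Nonempty (B ≃ₐ[K] D.R) →
      (0 < D.E.m → IsOfTypeA K B) ∧
      (D.E.m = 0 → 3 ≤ {i | ¬ D.E.IsSingleVariable i}.ncard → IsOfTypeB K B)) := by
  refine ⟨?_, ?_⟩
  · rintro D ⟨e⟩
    exact (D.isOfTypeA fun h => hB (h.of_equiv e)).of_equiv e.symm
  · rintro D ⟨e⟩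
    exact ⟨fun hm => (D.isOfTypeA hm).of_equiv e.symm, fun hm h3 =>
      (D.isOfTypeB hm h3 fun h => hB (h.of_equiv e)).of_equiv e.symm⟩
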